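/- Let $\beta,\gamma>0$ be fixed. For $n\ge 1$ let $m=\lfloor\beta n\rfloor$ and $p=\gamma/n$ (with $n$ large enough that $p\le 1$). Let $\mathcal B^{(n)}$ be the random bipartite graph with parts $\mathcal V=\{v_1,\dots,v_n\}$ and $\mathcal A=\{a_1,\dots,a_m\}$ in which each of the $nm$ possible edges is present independently with probability $p$. The random intersection graph $\mathcal G^{(n)}$ is the graph on $\mathcal V$ in which two distinct vertices are adjacent if and only if they have a common neighbour in $\mathcal A$ in $\mathcal B^{(n)}$. The size of a connected component is its number of vertices, and an event holds asymptotically almost surely (a.a.s.) if its probability tends to $1$ as $n\to\infty$. Set $\mu=\beta\gamma^2$, let $$g(s)=\exp\bigl\{\beta\gamma\bigl(e^{\gamma(s-1)}-1\bigr)\bigr\}$$ be the generating function of the compound Poisson distribution $\mathrm{CPoisson}(\beta\gamma,\gamma)$, and let $\rho$ be the smallest non-negative solution of $\rho=g(\rho)$. (i) If $\mu<1$, then there is a constant $C=C(\beta,\gamma)>0$ such that a.a.s. every connected component of $\mathcal G^{(n)}$ has at most $C\log n$ vertices. (ii) If $\mu>1$, then $0<\rho<1$, the size $L_1$ of the largest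 connected component of $\mathcal G^{(n)}$ satisfies $L_1/n\to 1-\rho$ in probability as $n\to\infty$, and there is a constant $C=C(\beta,\gamma)>0$ such that a.a.s. exactly one connected component of $\mathcal G^{(n)}$ has more than $C\log n$ vertices (the unique giant component) and the second largest connected component has at most $C\log n$ vertices. -/

import Mathlib

open MeasureTheory ProbabilityTheory Filter Topology

namespace RandomIntersectionGraph

/-- A bipartite graph between the vertices `v₁, …, vₙ` and the auxiliary vertices `a₁, …, aₘ`:
`B (i, k) = true` means that `vᵢ` and `aₖ` are adjacent. -/
abbrev Bipartite (n m : ℕ) : Type := Fin n × Fin m → Bool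

/-- The law of the random bipartite graph: every one of the `n * m` edges is present with
probability `p`, independently of the others. -/
noncomputable def bipartiteLaw (n m : ℕ) (p : unitInterval) : Measure (Bipartite n m) :=
  Measure.pi fun _ => bernoulliMeasure true false p

/-- The intersection graph of `B`: distinct vertices are adjacent iff they have a common
auxiliary neighbour. -/
def intersectionGraph {n m : ℕ} (B : Bipartite n m) : SimpleGraph (Fin n) where
  Adj i j := i ≠ j ∧ ∃ k : Fin m, B (i, k) = true ∧ B (j, k) = true
  symm := ⟨fun _ _ h => ⟨h.1.symm, h.2.imp fun _ hk => ⟨hk.2, hk.1⟩⟩⟩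
  loopless := ⟨fun _ h => h.1 rfl⟩

/-- The number of auxiliary vertices, `m = ⌊β n⌋`. -/
noncomputable def auxCount (β : ℝ) (n : ℕ) : ℕ := ⌊β * n⌋₊

/-- The edge probability `p = γ / n`, truncated to `[0, 1]`; for `γ > 0` the truncation only acts
at the finitely many `n` with `γ / n > 1`. -/
noncomputable def edgeProb (γ : ℝ) (n : ℕ) : unitInterval :=
  Set.projIcc (0 : ℝ) 1 zero_le_one (γ / n)

/-- The probability that the random intersection graph on `n` vertices, with `⌊β n⌋` auxiliary
vertices and edge probability `γ / n`, has the property `Q`. -/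
noncomputable def prob (β γ : ℝ) (n : ℕ) (Q : SimpleGraph (Fin n) → Prop) : ENNReal :=
  bipartiteLaw n (auxCount β n) (edgeProb γ n) {B | Q (intersectionGraph B)}

/-- A graph property holds asymptotically almost surely. -/
def AAS (β γ : ℝ) (Q : (n : ℕ) → SimpleGraph (Fin n) → Prop) : Prop :=
  Tendsto (fun n : ℕ => prob β γ n (Q n)) atTop (𝓝 1)

/-- A real-valued graph functional converges to the constant `a` in probability. -/
def TendstoInProb (β γ : ℝ) (X : (n : ℕ) → SimpleGraph (Fin n) → ℝ) (a : ℝ) : Prop :=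
  ∀ ε : ℝ, 0 < ε →
    Tendsto (fun n : ℕ => prob β γ n fun G => ε ≤ |X n G - a|) atTop (𝓝 0)

/-- The number of vertices of a connected component. -/
noncomputable def componentSize {V : Type*} {G : SimpleGraph V} (c : G.ConnectedComponent) : ℕ :=
  c.supp.ncard

/-- For `k ≥ 1`, the size of the `k`-th largest component, counted with multiplicity: the largest
`s` such that at least `k` components have `s` or more vertices
(and `0` if there are fewer than `k` components). -/
noncomputable def kthLargestSize {V : Type*} (G : SimpleGraph V) (k : ℕ) : ℕ :=
  sSup {s : ℕ | k ≤ {c : G.ConnectedComponent | s ≤ componentSize c}.ncard}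

/-- The generating function of the compound Poisson distribution `CPoisson(a, b)`. -/
noncomputable def cpoissonGF (a b s : ℝ) : ℝ :=
  Real.exp (a * (Real.exp (b * (s - 1)) - 1))

end RandomIntersectionGraph

/-!
Exploring the bipartite graph from a set of vertices reveals at each step fresh independent edges.
Hence, if `ζ` is a supersolution (resp. subsolution) of `ζ = s * g(ζ)`, then induction along the
exploration bounds the generating function `E[s ^ |cluster U|]` by `ζ ^ |U|` from above
(resp. below), with no branching process involved.

If `μ < 1`, then `g(ζ) < ζ` for some `ζ > 1`, and cluster sizes have exponential tails. If
`μ > 1`, every `ζ` strictly between `ρ` and `1` satisfies `g(ζ) < ζ`. As long as a cluster has at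
most `δ n` vertices, most of both parts remains unexplored, so the bound persists with some `s > 1`;
it excludes clusters of size between `C log n` and `δ n`, and shows that `v` and `w` both lie in
small clusters with probability at most about `ρ²`. Values `ζ < ρ` show that a single vertex lies
in a small cluster with probability at least about `ρ`. By the second moment method, about `ρ n`
vertices lie in small clusters. Finally, `√n` auxiliary vertices held back in the exploration join
any two clusters of size at least `δ n` to each other, so that the remaining `(1 - ρ) n` vertices
form a single component.
-/

namespace RandomIntersectionGraph

section Independence

lemma dependsOn_indicator_one {ι : Type*} {α : ι → Type*} {E : Set (∀ i, α i)} {S : Set ι}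
    (hE : DependsOn (· ∈ E) S) : DependsOn (E.indicator (1 : (∀ i, α i) → ℝ)) S := by
  classical
  intro ω ω' h
  rw [Set.indicator_apply, Set.indicator_apply, Pi.one_apply, Pi.one_apply]
  exact if_congr (iff_of_eq (hE h)) rfl rfl

variable {ι κ : Type*} [Fintype ι] {α : ι → Type*} [∀ i, MeasurableSpace (α i)] [∀ i, Finite (α i)]
  [∀ i, MeasurableSingletonClass (α i)] {μ : ∀ i, Measure (α i)} [∀ i, IsProbabilityMeasure (μ i)]

lemma integral_mul_of_dependsOn {f g : (∀ i, α i) → ℝ} {S T : Set ι} (hST : Disjoint S T)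
    (hf : DependsOn f S) (hg : DependsOn g T) :
    ∫ ω, f ω * g ω ∂Measure.pi μ = (∫ ω, f ω ∂Measure.pi μ) * ∫ ω, g ω ∂Measure.pi μ := by
  classical
  have hind : iIndepFun (fun i (ω : ∀ i, α i) => ω i) (Measure.pi μ) :=
    iIndepFun_pi (X := fun _ => id) fun _ => aemeasurable_id
  have hfin := hind.indepFun_finset S.toFinset T.toFinset (by simpa using hST)
    fun i => measurable_pi_apply i
  obtain ⟨f', rfl⟩ := dependsOn_iff_exists_comp.1 (hf.mono (t := (S.toFinset : Set ι)) (by simp))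
  obtain ⟨g', rfl⟩ := dependsOn_iff_exists_comp.1 (hg.mono (t := (T.toFinset : Set ι)) (by simp))
  exact (hfin.comp (φ := f') (ψ := g') .of_discrete .of_discrete).integral_mul_eq_mul_integral
    Integrable.of_finite.aestronglyMeasurable Integrable.of_finite.aestronglyMeasurable

lemma integral_prod_of_dependsOn (s : Finset κ) {f : κ → (∀ i, α i) → ℝ} {S : κ → Set ι}
    (hS : Pairwise (Function.onFun Disjoint S)) (hf : ∀ k, DependsOn (f k) (S k)) :
    ∫ ω, ∏ k ∈ s, f k ω ∂Measure.pi μ = ∏ k ∈ s, ∫ ω, f k ω ∂Measure.pi μ := by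
  classical
  induction s using Finset.induction_on with
  | empty => simp
  | insert k s hk ih =>
    have hdisj : Disjoint (S k) (⋃ l ∈ s, S l) :=
      Set.disjoint_iUnion₂_right.2 fun l hl => hS (ne_of_mem_of_not_mem hl hk).symm
    have hprod : DependsOn (fun ω => ∏ l ∈ s, f l ω) (⋃ l ∈ s, S l) := fun ω ω' h =>
      Finset.prod_congr rfl fun l hl => hf l fun i hi => h i (Set.mem_biUnion hl hi)
    simp only [Finset.prod_insert hk]
    rw [integral_mul_of_dependsOn hdisj (hf k) hprod, ih]

lemma integral_comp_eq_integral_integral {X : (∀ i, α i) → κ} {F : κ → (∀ i, α i) → ℝ}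
    {S T : Set ι} (hST : Disjoint S T) (hX : DependsOn X S)
    (hF : ∀ ω, DependsOn (F (X ω)) T) :
    ∫ ω, F (X ω) ω ∂Measure.pi μ = ∫ ω, ∫ ω', F (X ω) ω' ∂Measure.pi μ ∂Measure.pi μ := by
  classical
  have := Fintype.ofFinite (∀ i, α i)
  have hsum : ∀ G : κ → (∀ i, α i) → ℝ, ∀ ω, G (X ω) ω =
      ∑ k ∈ Finset.univ.image X, (if X ω = k then 1 else 0) * G k ω := fun G ω => by
    simp
  calc ∫ ω, F (X ω) ω ∂Measure.pi μ
      = ∑ k ∈ Finset.univ.image X,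
          ∫ ω, (if X ω = k then 1 else 0) * F k ω ∂Measure.pi μ := by
        rw [← integral_finsetSum _ fun _ _ => Integrable.of_finite]
        exact integral_congr_ae (.of_forall (hsum F))
    _ = ∑ k ∈ Finset.univ.image X,
          ∫ ω, (if X ω = k then 1 else 0) * ∫ ω', F k ω' ∂Measure.pi μ ∂Measure.pi μ := by
        refine Finset.sum_congr rfl fun k hk => ?_
        obtain ⟨ω₀, -, rfl⟩ := Finset.mem_image.1 hk
        rw [integral_mul_of_dependsOn hST (fun ω ω' h => by simp only [hX h]) (hF ω₀),
          integral_mul_const]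
    _ = ∫ ω, ∫ ω', F (X ω) ω' ∂Measure.pi μ ∂Measure.pi μ := by
        rw [← integral_finsetSum _ fun _ _ => Integrable.of_finite]
        exact integral_congr_ae
          (.of_forall fun ω => (hsum (fun k _ => ∫ ω', F k ω' ∂Measure.pi μ) ω).symm)

lemma measureReal_inter_of_dependsOn {E F : Set (∀ i, α i)} {S T : Set ι} (hST : Disjoint S T)
    (hE : DependsOn (· ∈ E) S) (hF : DependsOn (· ∈ F) T) :
    (Measure.pi μ).real (E ∩ F) = (Measure.pi μ).real E * (Measure.pi μ).real F := by
  have h := integral_mul_of_dependsOn (μ := μ) hST (dependsOn_indicator_one hE)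
    (dependsOn_indicator_one hF)
  have hind : ∀ ω, E.indicator (1 : (∀ i, α i) → ℝ) ω * F.indicator 1 ω = (E ∩ F).indicator 1 ω :=
    fun ω => by rw [Set.inter_indicator_one, Pi.mul_apply]
  simpa only [hind, integral_indicator_one (Set.toFinite _).measurableSet] using h

lemma measureReal_biInter_of_dependsOn (s : Finset κ) {E : κ → Set (∀ i, α i)} {S : κ → Set ι}
    (hS : Pairwise (Function.onFun Disjoint S)) (hE : ∀ k, DependsOn (· ∈ E k) (S k)) :
    (Measure.pi μ).real (⋂ k ∈ s, E k) = ∏ k ∈ s, (Measure.pi μ).real (E k) := by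
  classical
  have hind : ∀ ω, ∏ k ∈ s, (E k).indicator (1 : (∀ i, α i) → ℝ) ω =
      (⋂ k ∈ s, E k).indicator 1 ω := fun ω => by
    simp [Set.indicator, Finset.prod_ite_zero]
  have h := integral_prod_of_dependsOn (μ := μ) s hS fun k => dependsOn_indicator_one (hE k)
  simp only [hind, integral_indicator_one (Set.toFinite _).measurableSet] at h
  exact h

lemma measureReal_comp_le_of_dependsOn {X : (∀ i, α i) → κ} {E : κ → Set (∀ i, α i)}
    {S T : Set ι} {q : ℝ} (hST : Disjoint S T) (hX : DependsOn X S)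
    (hE : ∀ k, DependsOn (· ∈ E k) T) (hq : ∀ k, (Measure.pi μ).real (E k) ≤ q) :
    (Measure.pi μ).real {ω | ω ∈ E (X ω)} ≤ q := by
  have h := integral_comp_eq_integral_integral (μ := μ) hST hX (F := fun k => (E k).indicator 1)
    fun ω => dependsOn_indicator_one (hE (X ω))
  simp only [integral_indicator_one (Set.toFinite _).measurableSet] at h
  calc (Measure.pi μ).real {ω | ω ∈ E (X ω)}
      = ∫ ω, (E (X ω)).indicator 1 ω ∂Measure.pi μ :=
        (integral_indicator_one (Set.toFinite _).measurableSet).symm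
    _ = ∫ ω, (Measure.pi μ).real (E (X ω)) ∂Measure.pi μ := h
    _ ≤ ∫ _, q ∂Measure.pi μ :=
        integral_mono .of_finite (integrable_const q) fun ω => hq (X ω)
    _ = q := by simp

end Independence

section Exploration

variable {V : Type*}

open Classical in
/-- The neighbours of `x` in `G` that lie in `R`: the vertices discovered when an exploration of
`G` whose undiscovered vertices are those of `R` processes `x`. -/
noncomputable def nbrs (G : SimpleGraph V) (x : V) (R : Finset V) : Finset V :=
  R.filter (G.Adj x)

variable {G : SimpleGraph V} {U U' R R' S : Finset V} {x y : V}

lemma mem_nbrs : y ∈ nbrs G x R ↔ y ∈ R ∧ G.Adj x y := by simp [nbrs]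

lemma nbrs_subset : nbrs G x R ⊆ R := fun _ hy => (mem_nbrs.1 hy).1

section ExplorationStep

variable [DecidableEq V]

lemma erase_union_union_sdiff {N : Finset V} (hd : Disjoint U R) (hx : x ∈ U) (hN : N ⊆ R) :
    U.erase x ∪ N ∪ R \ N = (U ∪ R).erase x := by
  rw [Finset.union_assoc, Finset.union_sdiff_of_subset hN, Finset.erase_union_distrib,
    Finset.erase_eq_of_notMem (Finset.disjoint_left.1 hd hx)]

lemma disjoint_erase_union_sdiff (hd : Disjoint U R) (N : Finset V) :
    Disjoint (U.erase x ∪ N) (R \ N) :=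
  Finset.disjoint_union_left.2
    ⟨(hd.mono_left (Finset.erase_subset _ _)).mono_right Finset.sdiff_subset,
      Finset.disjoint_sdiff⟩

@[elab_as_elim]
theorem exploration_induction {motive : ∀ U R : Finset V, Disjoint U R → Prop}
    (empty : ∀ R, motive ∅ R (Finset.disjoint_empty_left R))
    (step : ∀ U R x (hd : Disjoint U R), x ∈ U →
      (∀ N, N ⊆ R → motive (U.erase x ∪ N) (R \ N) (disjoint_erase_union_sdiff hd N)) →
        motive U R hd)
    (U R : Finset V) (hd : Disjoint U R) : motive U R hd := by
  induction hk : (U ∪ R).card generalizing U R with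
  | zero =>
    obtain ⟨rfl, -⟩ := Finset.union_eq_empty.1 (Finset.card_eq_zero.1 hk)
    exact empty R
  | succ k ih =>
    obtain rfl | ⟨x, hx⟩ := U.eq_empty_or_nonempty
    · exact empty R
    refine step U R x hd hx fun N hN => ih _ _ _ ?_
    rw [erase_union_union_sdiff hd hx hN, Finset.card_erase_of_mem (Finset.mem_union_left _ hx), hk,
      Nat.add_sub_cancel]

end ExplorationStep

variable [Fintype V]

open Classical in
/-- The vertices that can be reached from `U` by paths in `G` that stay in `R` after their first
vertex: the vertices discovered by an exploration of `G` started from `U` inside `U ∪ R`. -/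
noncomputable def reach (G : SimpleGraph V) (U R : Finset V) : Finset V :=
  Finset.univ.filter fun x => ∃ u ∈ U, Relation.ReflTransGen (fun y z => G.Adj y z ∧ z ∈ R) u x

lemma mem_reach : x ∈ reach G U R ↔
    ∃ u ∈ U, Relation.ReflTransGen (fun y z => G.Adj y z ∧ z ∈ R) u x := by
  simp [reach]

lemma subset_reach : U ⊆ reach G U R := fun x hx => mem_reach.2 ⟨x, hx, .refl⟩

lemma mem_reach_of_adj (hx : x ∈ reach G U R) (h : G.Adj x y) (hy : y ∈ R) :
    y ∈ reach G U R := by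
  obtain ⟨u, hu, hux⟩ := mem_reach.1 hx
  exact mem_reach.2 ⟨u, hu, hux.tail ⟨h, hy⟩⟩

lemma reach_subset (hU : U ⊆ S) (h : ∀ x ∈ S, ∀ y ∈ R, G.Adj x y → y ∈ S) :
    reach G U R ⊆ S := by
  intro x hx
  obtain ⟨u, hu, hux⟩ := mem_reach.1 hx
  induction hux with
  | refl => exact hU hu
  | tail h₁ h₂ ih => exact h _ (ih (mem_reach.2 ⟨u, hu, h₁⟩)) _ h₂.2 h₂.1

lemma reach_mono (hU : U ⊆ U') (hR : R ⊆ R') : reach G U R ⊆ reach G U' R' :=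
  reach_subset (hU.trans subset_reach) fun _ hx _ hy h => mem_reach_of_adj hx h (hR hy)

@[simp] lemma reach_empty : reach G ∅ R = ∅ :=
  Finset.subset_empty.1 (reach_subset (by simp) (by simp))

variable [DecidableEq V]

lemma reach_subset_union : reach G U R ⊆ U ∪ R :=
  reach_subset Finset.subset_union_left fun _ _ _ hy _ => Finset.mem_union_right _ hy

lemma reach_sdiff_self : reach G U (R \ U) = reach G U R := by
  refine (reach_mono subset_rfl Finset.sdiff_subset).antisymm
    (reach_subset subset_reach fun x hx y hy h => ?_)
  by_cases hyU : y ∈ U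
  · exact subset_reach hyU
  · exact mem_reach_of_adj hx h (Finset.mem_sdiff.2 ⟨hy, hyU⟩)

lemma reach_eq_insert (hx : x ∈ U) :
    reach G U R = insert x (reach G (U.erase x ∪ nbrs G x R) (R \ nbrs G x R)) := by
  apply Finset.Subset.antisymm
  · refine reach_subset (fun y hy => ?_) fun y hy z hz h => ?_
    · by_cases hyx : y = x
      · simp [hyx]
      · exact Finset.mem_insert_of_mem (subset_reach (by simp [hyx, hy]))
    · by_cases hzN : z ∈ nbrs G x R
      · exact Finset.mem_insert_of_mem (subset_reach (by simp [hzN]))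
      · rcases Finset.mem_insert.1 hy with rfl | hy
        · exact absurd (mem_nbrs.2 ⟨hz, h⟩) hzN
        · exact Finset.mem_insert_of_mem (mem_reach_of_adj hy h (by simp [hz, hzN]))
  · refine Finset.insert_subset (subset_reach hx) (reach_subset ?_ ?_)
    · refine Finset.union_subset ((Finset.erase_subset _ _).trans subset_reach) fun y hy => ?_
      exact mem_reach_of_adj (subset_reach hx) (mem_nbrs.1 hy).2 (mem_nbrs.1 hy).1
    · exact fun y hy z hz h => mem_reach_of_adj hy h (Finset.mem_sdiff.1 hz).1

lemma notMem_reach_step (hd : Disjoint U R) (hx : x ∈ U) :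
    x ∉ reach G (U.erase x ∪ nbrs G x R) (R \ nbrs G x R) := fun h => by
  have := reach_subset_union h
  simp [erase_union_union_sdiff hd hx nbrs_subset] at this

lemma sdiff_reach_step (hd : Disjoint U R) (hx : x ∈ U) :
    R \ reach G U R =
      (R \ nbrs G x R) \ reach G (U.erase x ∪ nbrs G x R) (R \ nbrs G x R) := by
  have hN : nbrs G x R ⊆ reach G (U.erase x ∪ nbrs G x R) (R \ nbrs G x R) :=
    Finset.subset_union_right.trans subset_reach
  rw [reach_eq_insert hx, Finset.sdiff_insert, sdiff_sdiff_left, Finset.sup_eq_union,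
    Finset.union_eq_right.2 hN, Finset.erase_eq_of_notMem]
  exact fun h => Finset.disjoint_left.1 hd hx (Finset.mem_sdiff.1 h).1

end Exploration

section Percolation

variable {V ι : Type*} {ends : ι → Sym2 V} {ω ω' : ι → Bool} {x y : V}

/-- The graph formed by the open edges of the configuration `ω`, where `ends i` is the pair of end
vertices of the potential edge `i`. -/
def openGraph (ends : ι → Sym2 V) (ω : ι → Bool) : SimpleGraph V :=
  .fromEdgeSet {e | ∃ i, ends i = e ∧ ω i = true}

lemma openGraph_adj : (openGraph ends ω).Adj x y ↔ (∃ i, ends i = s(x, y) ∧ ω i = true) ∧ x ≠ y :=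
  SimpleGraph.fromEdgeSet_adj _

lemma dependsOn_openGraph_adj :
    DependsOn (fun ω => (openGraph ends ω).Adj x y) {i | ends i = s(x, y)} := by
  intro ω ω' h
  simp only [openGraph_adj]
  refine propext (and_congr_left' (exists_congr fun i => and_congr_right fun hi => ?_))
  rw [h i hi]

lemma dependsOn_nbrs (R : Finset V) :
    DependsOn (fun ω => nbrs (openGraph ends ω) x R) {i | x ∈ ends i} := by
  intro ω ω' h
  ext y
  have hadj := dependsOn_openGraph_adj (ends := ends) (x := x) (y := y)
    fun i hi => h i (by rw [Set.mem_ofPred_eq] at hi ⊢; simp [hi])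
  simp only [mem_nbrs, hadj]

lemma dependsOn_reach [Fintype V] [DecidableEq V] (U R : Finset V) :
    DependsOn (fun ω => reach (openGraph ends ω) U R) {i | ∀ y ∈ ends i, y ∈ U ∪ R} := by
  have subset_of_agree : ∀ ω ω' : ι → Bool, (∀ i, (∀ y ∈ ends i, y ∈ U ∪ R) → ω i = ω' i) →
      reach (openGraph ends ω) U R ⊆ reach (openGraph ends ω') U R := by
    intro ω ω' h
    refine reach_subset subset_reach fun x hx y hy hxy => mem_reach_of_adj hx ?_ hy
    refine (dependsOn_openGraph_adj fun i (hi : ends i = s(x, y)) => h i ?_).mp hxy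
    simp only [hi, Sym2.mem_iff, forall_eq_or_imp, forall_eq]
    exact ⟨reach_subset_union hx, Finset.mem_union_right _ hy⟩
  exact fun ω ω' h => (subset_of_agree ω ω' h).antisymm
    (subset_of_agree ω' ω fun i hi => (h i hi).symm)

variable [Fintype ι] {μ : ι → Measure Bool} [∀ i, IsProbabilityMeasure (μ i)]

/-- The probability that `x` and `y` are adjacent in the random graph of open edges. -/
noncomputable def adjProb (ends : ι → Sym2 V) (μ : ι → Measure Bool) (x y : V) : ℝ :=
  (Measure.pi μ).real {ω | (openGraph ends ω).Adj x y}

lemma integral_prod_nbrs (ζ : V → ℝ) (x : V) (R : Finset V) :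
    ∫ ω, ∏ y ∈ nbrs (openGraph ends ω) x R, ζ y ∂Measure.pi μ =
      ∏ y ∈ R, (1 + adjProb ends μ x y * (ζ y - 1)) := by
  classical
  have hdisj : Pairwise (Function.onFun Disjoint fun y => {i | ends i = s(x, y)}) := by
    refine fun y z hyz => Set.disjoint_left.2 fun i (hy : ends i = _) (hz : ends i = _) => hyz ?_
    exact Sym2.congr_right.1 (hy.symm.trans hz)
  have hfactor : ∀ y, ∫ ω, (if (openGraph ends ω).Adj x y then ζ y else 1) ∂Measure.pi μ =
      1 + adjProb ends μ x y * (ζ y - 1) := fun y => by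
    have : ∀ ω, (if (openGraph ends ω).Adj x y then ζ y else 1) =
        1 + {ω | (openGraph ends ω).Adj x y}.indicator 1 ω * (ζ y - 1) := fun ω => by
      by_cases h : (openGraph ends ω).Adj x y <;> simp [h]
    simp only [this]
    rw [integral_add .of_finite .of_finite, integral_mul_const,
      integral_indicator_one (Set.toFinite _).measurableSet]
    simp [adjProb]
  simp only [nbrs, Finset.prod_filter]
  rw [integral_prod_of_dependsOn R hdisj fun y ω ω' h => by simp only [dependsOn_openGraph_adj h]]
  exact Finset.prod_congr rfl fun y _ => hfactor y

variable [Fintype V] [DecidableEq V]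

open Classical in
/-- The expectation of `∏ z` over the set reached from `U` inside `U ∪ R`, restricted to the event
that the unreached part of `R` satisfies `P`. -/
noncomputable def exploredWeight (ends : ι → Sym2 V) (μ : ι → Measure Bool) (z : V → ℝ)
    (P : Finset V → Prop) (U R : Finset V) : ℝ :=
  ∫ ω, (if P (R \ reach (openGraph ends ω) U R) then ∏ x ∈ reach (openGraph ends ω) U R, z x
    else 0) ∂Measure.pi μ

variable {z ζ : V → ℝ} {P : Finset V → Prop} {U R : Finset V}

theorem exploredWeight_step (hd : Disjoint U R) (hx : x ∈ U) :
    exploredWeight ends μ z P U R = ∫ ω, z x * exploredWeight ends μ z P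
      (U.erase x ∪ nbrs (openGraph ends ω) x R) (R \ nbrs (openGraph ends ω) x R)
        ∂Measure.pi μ := by
  classical
  let F (N : Finset V) (ω : ι → Bool) : ℝ :=
    if P ((R \ N) \ reach (openGraph ends ω) (U.erase x ∪ N) (R \ N)) then
      ∏ y ∈ reach (openGraph ends ω) (U.erase x ∪ N) (R \ N), z y else 0
  have hpeel : ∀ ω, (if P (R \ reach (openGraph ends ω) U R) then
      ∏ x ∈ reach (openGraph ends ω) U R, z x else 0) =
        z x * F (nbrs (openGraph ends ω) x R) ω := fun ω => by
    simp only [F, ← sdiff_reach_step hd hx, mul_ite, mul_zero]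
    rw [reach_eq_insert hx, Finset.prod_insert (notMem_reach_step hd hx)]
  have hF : ∀ ω, DependsOn (F (nbrs (openGraph ends ω) x R)) {i | x ∉ ends i} := by
    intro ω ω₁ ω₂ h
    refine congrArg (fun X => if P ((R \ _) \ X) then ∏ y ∈ X, z y else 0)
      (dependsOn_reach _ _ fun i hi => h i fun hxi => ?_)
    simpa [erase_union_union_sdiff hd hx nbrs_subset] using hi x hxi
  rw [exploredWeight]
  simp only [hpeel, integral_const_mul]
  rw [integral_comp_eq_integral_integral (disjoint_compl_right (a := {i | x ∈ ends i}))
    (dependsOn_nbrs R) hF]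
  simp only [F, exploredWeight]

theorem exploredWeight_le_prod (hz : ∀ x, 0 ≤ z x) (hζ : ∀ x, 0 ≤ ζ x) (hP : Monotone P)
    (hsuper : ∀ R x, P R → z x * ∏ y ∈ R, (1 + adjProb ends μ x y * (ζ y - 1)) ≤ ζ x)
    (U R : Finset V) (hd : Disjoint U R) :
    exploredWeight ends μ z P U R ≤ ∏ x ∈ U, ζ x := by
  induction U, R, hd using exploration_induction with
  | empty R => by_cases h : P R <;> simp [exploredWeight, h]
  | step U R x hd hx ih =>
    by_cases hPR : P R
    · calc exploredWeight ends μ z P U R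
          ≤ ∫ ω, z x * ∏ y ∈ U.erase x ∪ nbrs (openGraph ends ω) x R, ζ y ∂Measure.pi μ := by
            rw [exploredWeight_step hd hx]
            exact integral_mono .of_finite .of_finite fun ω =>
              mul_le_mul_of_nonneg_left (ih _ nbrs_subset) (hz x)
        _ = (∏ y ∈ U.erase x, ζ y) *
              (z x * ∏ y ∈ R, (1 + adjProb ends μ x y * (ζ y - 1))) := by
            rw [← integral_prod_nbrs, ← integral_const_mul, ← integral_const_mul]
            congr 1 with ω
            rw [Finset.prod_union ((hd.mono_right nbrs_subset).mono_left (Finset.erase_subset _ _))]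
            ring
        _ ≤ (∏ y ∈ U.erase x, ζ y) * ζ x :=
            mul_le_mul_of_nonneg_left (hsuper R x hPR) (Finset.prod_nonneg fun y _ => hζ y)
        _ = ∏ y ∈ U, ζ y := Finset.prod_erase_mul _ _ hx
    · have hzero : exploredWeight ends μ z P U R = 0 :=
        integral_eq_zero_of_ae (.of_forall fun ω =>
          if_neg fun h => hPR (hP Finset.sdiff_subset h))
      exact hzero.trans_le (Finset.prod_nonneg fun y _ => hζ y)

theorem prod_le_exploredWeight (hz : ∀ x, 0 ≤ z x) (hζ : ∀ x, 0 ≤ ζ x)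
    (hsub : ∀ R x, ζ x ≤ z x * ∏ y ∈ R, (1 + adjProb ends μ x y * (ζ y - 1)))
    (U R : Finset V) (hd : Disjoint U R) :
    ∏ x ∈ U, ζ x ≤ exploredWeight ends μ z (fun _ => True) U R := by
  induction U, R, hd using exploration_induction with
  | empty R => simp [exploredWeight]
  | step U R x hd hx ih =>
    calc ∏ y ∈ U, ζ y = (∏ y ∈ U.erase x, ζ y) * ζ x := (Finset.prod_erase_mul _ _ hx).symm
      _ ≤ (∏ y ∈ U.erase x, ζ y) * (z x * ∏ y ∈ R, (1 + adjProb ends μ x y * (ζ y - 1))) :=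
          mul_le_mul_of_nonneg_left (hsub R x) (Finset.prod_nonneg fun y _ => hζ y)
      _ = ∫ ω, z x * ∏ y ∈ U.erase x ∪ nbrs (openGraph ends ω) x R, ζ y ∂Measure.pi μ := by
          rw [← integral_prod_nbrs, ← integral_const_mul, ← integral_const_mul]
          congr 1 with ω
          rw [Finset.prod_union ((hd.mono_right nbrs_subset).mono_left (Finset.erase_subset _ _))]
          ring
      _ ≤ exploredWeight ends μ z (fun _ => True) U R := by
          rw [exploredWeight_step hd hx]
          exact integral_mono .of_finite .of_finite fun ω =>
            mul_le_mul_of_nonneg_left (ih _ nbrs_subset) (hz x)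

end Percolation

section Cluster

variable {V : Type*} [Fintype V] {G H : SimpleGraph V} {U : Finset V} {v w : V}

open Classical in
/-- The vertices of the connected components of `G` that meet `U`. -/
noncomputable def cluster (G : SimpleGraph V) (U : Finset V) : Finset V :=
  Finset.univ.filter fun w => ∃ u ∈ U, G.Reachable u w

lemma mem_cluster : w ∈ cluster G U ↔ ∃ u ∈ U, G.Reachable u w := by simp [cluster]

lemma mem_cluster_singleton : w ∈ cluster G {v} ↔ G.Reachable v w := by simp [mem_cluster]

lemma subset_cluster : U ⊆ cluster G U := fun u hu => mem_cluster.2 ⟨u, hu, .refl u⟩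

lemma cluster_mono (h : G ≤ H) : cluster G U ⊆ cluster H U := fun w hw => by
  obtain ⟨u, hu, huw⟩ := mem_cluster.1 hw
  exact mem_cluster.2 ⟨u, hu, huw.mono h⟩

lemma cluster_eq_of_reachable (h : G.Reachable v w) : cluster G {v} = cluster G {w} := by
  ext x
  simp only [mem_cluster_singleton]
  exact ⟨h.symm.trans, h.trans⟩

lemma cluster_pair_subset [DecidableEq V] :
    cluster G {v, w} ⊆ cluster G {v} ∪ cluster G {w} := by
  intro x
  simp [mem_cluster]

lemma componentSize_mk (v : V) :
    componentSize (G.connectedComponentMk v) = (cluster G {v}).card := by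
  rw [componentSize, ← Set.ncard_coe_finset]
  congr 1
  ext w
  simp only [SimpleGraph.ConnectedComponent.mem_supp_iff, SimpleGraph.ConnectedComponent.eq,
    Finset.mem_coe, mem_cluster_singleton]
  exact SimpleGraph.reachable_comm

end Cluster

section IntersectionGraph

variable {n m : ℕ} {p : unitInterval} {B : Bipartite n m} {A A' : Finset (Fin m)}
  {U : Finset (Fin n)} {v w : Fin n}

/-- The intersection graph formed with the auxiliary vertices of `A` only: distinct vertices are
adjacent iff they have a common neighbour in `A`. -/
def intersectionGraphVia (B : Bipartite n m) (A : Finset (Fin m)) : SimpleGraph (Fin n) where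
  Adj v w := v ≠ w ∧ ∃ a ∈ A, B (v, a) = true ∧ B (w, a) = true
  symm := ⟨fun _ _ h => ⟨h.1.symm, h.2.imp fun _ ha => ⟨ha.1, ha.2.2, ha.2.1⟩⟩⟩
  loopless := ⟨fun _ h => h.1 rfl⟩

lemma intersectionGraphVia_univ : intersectionGraphVia B Finset.univ = intersectionGraph B := by
  ext v w
  simp [intersectionGraphVia, intersectionGraph]

lemma intersectionGraphVia_mono (h : A ⊆ A') :
    intersectionGraphVia B A ≤ intersectionGraphVia B A' :=
  fun _ _ hvw => ⟨hvw.1, hvw.2.imp fun _ ha => ⟨h ha.1, ha.2⟩⟩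

lemma reachable_of_common_neighbor {a : Fin m} (ha : a ∈ A) (hv : B (v, a) = true)
    (hw : B (w, a) = true) : (intersectionGraphVia B A).Reachable v w := by
  obtain rfl | hvw := eq_or_ne v w
  · exact .refl v
  · exact SimpleGraph.Adj.reachable ⟨hvw, a, ha, hv, hw⟩

lemma dependsOn_intersectionGraphVia :
    DependsOn (fun B : Bipartite n m => intersectionGraphVia B A) {e | e.2 ∈ A} := by
  intro B B' h
  ext v w
  refine and_congr_right fun _ => exists_congr fun a => and_congr_right fun ha => ?_
  rw [h (v, a) ha, h (w, a) ha]

/-- The auxiliary vertices of `A` that belong to the components of `U` in the bipartite graph `B`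
from which the auxiliary vertices outside `A` have been deleted. -/
noncomputable def auxCluster (B : Bipartite n m) (A : Finset (Fin m)) (U : Finset (Fin n)) :
    Finset (Fin m) :=
  A.filter fun a => ∃ w ∈ cluster (intersectionGraphVia B A) U, B (w, a) = true

lemma mem_auxCluster {a : Fin m} : a ∈ auxCluster B A U ↔
    a ∈ A ∧ ∃ w ∈ cluster (intersectionGraphVia B A) U, B (w, a) = true := Finset.mem_filter

lemma auxCluster_subset (B : Bipartite n m) (A : Finset (Fin m)) (U : Finset (Fin n)) :
    auxCluster B A U ⊆ A := Finset.filter_subset _ _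

/-- The end vertices of the potential edges of the bipartite graph, on the disjoint union of its
parts. -/
def bipartiteEnds (e : Fin n × Fin m) : Sym2 (Fin n ⊕ Fin m) := s(.inl e.1, .inr e.2)

lemma openGraph_bipartiteEnds_adj_inl_inr {a : Fin m} :
    (openGraph bipartiteEnds B).Adj (.inl v) (.inr a) ↔ B (v, a) = true := by
  simp [openGraph_adj, bipartiteEnds]

lemma not_openGraph_bipartiteEnds_adj_inl_inl :
    ¬ (openGraph bipartiteEnds B).Adj (.inl v) (.inl w) := by
  simp [openGraph_adj, bipartiteEnds]

lemma not_openGraph_bipartiteEnds_adj_inr_inr {a b : Fin m} :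
    ¬ (openGraph bipartiteEnds B).Adj (.inr a) (.inr b) := by
  simp [openGraph_adj, bipartiteEnds]

lemma inl_mem_reach_of_mem_cluster (hw : w ∈ cluster (intersectionGraphVia B A) U) :
    .inl w ∈ reach (openGraph bipartiteEnds B) (U.map .inl) (Finset.univ.disjSum A) := by
  obtain ⟨u, hu, huw⟩ := mem_cluster.1 hw
  rw [SimpleGraph.reachable_iff_reflTransGen] at huw
  induction huw with
  | refl => exact subset_reach (by simpa using hu)
  | @tail x y hux hxy ih =>
    obtain ⟨-, a, ha, hxa, hya⟩ := hxy
    have haR := mem_reach_of_adj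
      (ih (mem_cluster.2 ⟨u, hu, (SimpleGraph.reachable_iff_reflTransGen u x).2 hux⟩))
      (openGraph_bipartiteEnds_adj_inl_inr.2 hxa) (by simpa using ha)
    exact mem_reach_of_adj haR (openGraph_bipartiteEnds_adj_inl_inr.2 hya).symm (by simp)

theorem reach_bipartiteEnds :
    reach (openGraph bipartiteEnds B) (U.map .inl) (Finset.univ.disjSum A) =
      (cluster (intersectionGraphVia B A) U).disjSum (auxCluster B A U) := by
  refine (reach_subset ?_ ?_).antisymm ?_
  · intro x hx
    obtain ⟨u, hu, rfl⟩ := Finset.mem_map.1 hx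
    exact Finset.inl_mem_disjSum.2 (subset_cluster hu)
  · rintro (w | a) hx (v | b) hy hxy
    · exact absurd hxy not_openGraph_bipartiteEnds_adj_inl_inl
    · exact Finset.inr_mem_disjSum.2 (mem_auxCluster.2 ⟨Finset.inr_mem_disjSum.1 hy, w,
        Finset.inl_mem_disjSum.1 hx, openGraph_bipartiteEnds_adj_inl_inr.1 hxy⟩)
    · obtain ⟨ha, w, hw, hwa⟩ := mem_auxCluster.1 (Finset.inr_mem_disjSum.1 hx)
      obtain ⟨u, hu, huw⟩ := mem_cluster.1 hw
      have hva := openGraph_bipartiteEnds_adj_inl_inr.1 hxy.symm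
      exact Finset.inl_mem_disjSum.2
        (mem_cluster.2 ⟨u, hu, huw.trans (reachable_of_common_neighbor ha hwa hva)⟩)
    · exact absurd hxy not_openGraph_bipartiteEnds_adj_inr_inr
  · rintro (w | a) hx
    · exact inl_mem_reach_of_mem_cluster (Finset.inl_mem_disjSum.1 hx)
    · obtain ⟨ha, w, hw, hwa⟩ := mem_auxCluster.1 (Finset.inr_mem_disjSum.1 hx)
      exact mem_reach_of_adj (inl_mem_reach_of_mem_cluster hw)
        (openGraph_bipartiteEnds_adj_inl_inr.2 hwa) (by simpa using ha)

instance : IsProbabilityMeasure (bipartiteLaw n m p) := by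
  unfold bipartiteLaw; infer_instance

lemma bipartiteLaw_real_edge (e : Fin n × Fin m) :
    (bipartiteLaw n m p).real {B | B e = true} = p := by
  have h := (measurePreserving_eval (fun _ : Fin n × Fin m => bernoulliMeasure true false p)
    e).measureReal_preimage (s := {true}) (MeasurableSet.singleton true).nullMeasurableSet
  calc (bipartiteLaw n m p).real {B | B e = true}
      = (bernoulliMeasure true false p).real {true} := h
    _ = p := by simp

lemma prod_one_add_adjProb_inl (ζ : Fin n ⊕ Fin m → ℝ) (v : Fin n) (R : Finset (Fin n ⊕ Fin m)) :
    ∏ y ∈ R, (1 + adjProb bipartiteEnds (fun _ => bernoulliMeasure true false p) (.inl v) y *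
      (ζ y - 1)) = ∏ a ∈ R.toRight, (1 + p * (ζ (.inr a) - 1)) := by
  have hinl : ∀ w, adjProb (bipartiteEnds (m := m))
      (fun _ => bernoulliMeasure true false p) (.inl v) (.inl w) = 0 := fun w => by
    simp [adjProb, not_openGraph_bipartiteEnds_adj_inl_inl]
  have hinr : ∀ a, adjProb (bipartiteEnds (m := m))
      (fun _ => bernoulliMeasure true false p) (.inl v) (.inr a) = p := fun a => by
    simp only [adjProb, openGraph_bipartiteEnds_adj_inl_inr]
    exact bipartiteLaw_real_edge (v, a)
  conv_lhs => rw [← Finset.toLeft_disjSum_toRight (u := R), Finset.prod_disjSum]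
  simp [hinl, hinr]

lemma prod_one_add_adjProb_inr (ζ : Fin n ⊕ Fin m → ℝ) (a : Fin m) (R : Finset (Fin n ⊕ Fin m)) :
    ∏ y ∈ R, (1 + adjProb bipartiteEnds (fun _ => bernoulliMeasure true false p) (.inr a) y *
      (ζ y - 1)) = ∏ v ∈ R.toLeft, (1 + p * (ζ (.inl v) - 1)) := by
  have hinl : ∀ v, adjProb (bipartiteEnds (n := n))
      (fun _ => bernoulliMeasure true false p) (.inr a) (.inl v) = p := fun v => by
    simp only [adjProb, SimpleGraph.adj_comm _ (Sum.inr a), openGraph_bipartiteEnds_adj_inl_inr]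
    exact bipartiteLaw_real_edge (v, a)
  have hinr : ∀ b, adjProb (bipartiteEnds (n := n))
      (fun _ => bernoulliMeasure true false p) (.inr a) (.inr b) = 0 := fun b => by
    simp [adjProb, not_openGraph_bipartiteEnds_adj_inr_inr]
  conv_lhs => rw [← Finset.toLeft_disjSum_toRight (u := R), Finset.prod_disjSum]
  simp [hinl, hinr]

end IntersectionGraph

section MomentBounds

variable {n m : ℕ} {p : unitInterval} {a b s t ζ : ℝ}

open Classical in
theorem integral_cluster_pow_mul_auxCluster_pow_le {η : ℝ} {P : ℕ → ℕ → Prop}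
    (hs : 0 ≤ s) (ht : 0 ≤ t) (hζ : 0 ≤ ζ) (hη : 0 ≤ η)
    (hP : ∀ ⦃i i' j j'⦄, i ≤ i' → j ≤ j' → P i j → P i' j')
    (hζ_super : ∀ i ≤ n, ∀ j ≤ m, P i j → s * (1 + p * (η - 1)) ^ j ≤ ζ)
    (hη_super : ∀ i ≤ n, ∀ j ≤ m, P i j → t * (1 + p * (ζ - 1)) ^ i ≤ η)
    (A : Finset (Fin m)) (U : Finset (Fin n)) :
    ∫ B, (if P (cluster (intersectionGraphVia B A) U)ᶜ.card (A \ auxCluster B A U).card then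
        s ^ (cluster (intersectionGraphVia B A) U).card * t ^ (auxCluster B A U).card
      else 0) ∂bipartiteLaw n m p ≤ ζ ^ U.card := by
  have hle : exploredWeight bipartiteEnds (fun _ => bernoulliMeasure true false p)
      (Sum.elim (fun _ => s) fun _ => t) (fun R => P R.toLeft.card R.toRight.card)
      (U.map .inl) (Finset.univ.disjSum A \ U.map .inl) ≤
        ∏ x ∈ (U.map .inl : Finset (Fin n ⊕ Fin m)), Sum.elim (fun _ => ζ) (fun _ => η) x := by
    refine exploredWeight_le_prod (by rintro (_ | _) <;> simpa) (by rintro (_ | _) <;> simpa)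
      (fun R R' h => hP (by gcongr) (by gcongr)) (fun R x hR => ?_) _ _
      Finset.disjoint_sdiff
    have hleft : R.toLeft.card ≤ n := R.toLeft.card_le_univ.trans_eq (Fintype.card_fin n)
    have hright : R.toRight.card ≤ m := R.toRight.card_le_univ.trans_eq (Fintype.card_fin m)
    rcases x with v | k
    · simpa [prod_one_add_adjProb_inl] using hζ_super _ hleft _ hright hR
    · simpa [prod_one_add_adjProb_inr] using hη_super _ hleft _ hright hR
  have hunreached : ∀ B : Bipartite n m,
      (Finset.univ.disjSum A \ U.map .inl) \
        (cluster (intersectionGraphVia B A) U).disjSum (auxCluster B A U) =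
      (cluster (intersectionGraphVia B A) U)ᶜ.disjSum (A \ auxCluster B A U) := fun B => by
    ext (v | k)
    · simpa using fun hv hvU => hv (subset_cluster hvU)
    · simp
  simpa [exploredWeight, reach_sdiff_self, reach_bipartiteEnds, hunreached, Finset.prod_disjSum,
    bipartiteLaw] using hle

theorem le_integral_cluster_pow_of_subsolution {η : ℝ} (hs : 0 ≤ s) (hζ : 0 ≤ ζ) (hη : 0 ≤ η)
    (hζ_sub : ∀ j ≤ m, ζ ≤ s * (1 + p * (η - 1)) ^ j)
    (hη_sub : ∀ i ≤ n, η ≤ (1 + p * (ζ - 1)) ^ i) (A : Finset (Fin m)) (U : Finset (Fin n)) :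
    ζ ^ U.card ≤ ∫ B, s ^ (cluster (intersectionGraphVia B A) U).card ∂bipartiteLaw n m p := by
  have hle : ∏ x ∈ (U.map .inl : Finset (Fin n ⊕ Fin m)), Sum.elim (fun _ => ζ) (fun _ => η) x ≤
      exploredWeight bipartiteEnds (fun _ => bernoulliMeasure true false p)
        (Sum.elim (fun _ => s) fun _ => 1) (fun _ => True)
        (U.map .inl) (Finset.univ.disjSum A \ U.map .inl) := by
    refine prod_le_exploredWeight (by rintro (_ | _) <;> simp [hs])
      (by rintro (_ | _) <;> simpa) (fun R x => ?_) _ _ Finset.disjoint_sdiff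
    have hleft : R.toLeft.card ≤ n := R.toLeft.card_le_univ.trans_eq (Fintype.card_fin n)
    have hright : R.toRight.card ≤ m := R.toRight.card_le_univ.trans_eq (Fintype.card_fin m)
    rcases x with v | k
    · simpa [prod_one_add_adjProb_inl] using hζ_sub _ hright
    · simpa [prod_one_add_adjProb_inr] using hη_sub _ hleft
  simpa [exploredWeight, reach_sdiff_self, reach_bipartiteEnds, Finset.prod_disjSum,
    bipartiteLaw] using hle

lemma one_add_mul_pow_le_exp {x y z : ℝ} {k : ℕ} (hx : 0 ≤ 1 + x * y) (h : k * x * y ≤ z) :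
    (1 + x * y) ^ k ≤ Real.exp z := by
  calc (1 + x * y) ^ k ≤ Real.exp (x * y) ^ k :=
        pow_le_pow_left₀ hx (by linarith [Real.add_one_le_exp (x * y)]) k
    _ = Real.exp (k * x * y) := by rw [← Real.exp_nat_mul, mul_assoc]
    _ ≤ Real.exp z := Real.exp_le_exp.2 h

lemma exp_mul_le_one_add_mul_pow {q y : ℝ} {k : ℕ} (hq : 0 ≤ q) (hq1 : q < 1)
    (h : k * q ≤ (1 - q) * a) (hy : -1 ≤ y) (hy0 : y ≤ 0) :
    Real.exp (a * y) ≤ (1 + q * y) ^ k := by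
  have hpos : 0 < 1 + q * y := by nlinarith
  have hkqy : a * y * (1 - q) ≤ k * q * y := by nlinarith
  have hkq : 0 ≤ k * q * -y := by have := neg_nonneg.2 hy0; positivity
  rw [← Real.le_log_iff_exp_le (by positivity), Real.log_pow]
  calc a * y ≤ k * q * y / (1 - q) := (le_div_iff₀ (by linarith)).2 hkqy
    _ ≤ k * q * y / (1 + q * y) := by
        rw [div_le_div_iff₀ (by linarith) hpos]
        exact mul_le_mul_of_nonpos_left (by nlinarith) (by linarith)
    _ = k * (1 - (1 + q * y)⁻¹) := by field_simp; ring
    _ ≤ k * Real.log (1 + q * y) := by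
        gcongr
        exact Real.one_sub_inv_le_log_of_pos hpos

theorem integral_cluster_pow_mul_auxCluster_pow_le_of_one_le (hs : 0 ≤ s) (ht : 1 ≤ t)
    (hζ : 1 ≤ ζ) (hb : 0 ≤ b) (hm : m * (p : ℝ) ≤ a) (hn : n * (p : ℝ) ≤ b)
    (h : s * Real.exp (a * (t * Real.exp (b * (ζ - 1)) - 1)) ≤ ζ)
    (A : Finset (Fin m)) (U : Finset (Fin n)) :
    ∫ B, s ^ (cluster (intersectionGraphVia B A) U).card * t ^ (auxCluster B A U).card
      ∂bipartiteLaw n m p ≤ ζ ^ U.card := by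
  have hp : 0 ≤ (p : ℝ) := p.2.1
  have hη : 1 ≤ t * Real.exp (b * (ζ - 1)) :=
    one_le_mul_of_one_le_of_one_le ht (Real.one_le_exp (mul_nonneg hb (by linarith)))
  have hexp : ∀ {k l : ℕ} {x c : ℝ}, 1 ≤ x → k ≤ l → l * (p : ℝ) ≤ c →
      (1 + p * (x - 1)) ^ k ≤ Real.exp (c * (x - 1)) := fun {k l x c} hx hkl hl => by
    have hk : (k : ℝ) * p ≤ c := le_trans (by gcongr) hl
    exact one_add_mul_pow_le_exp (by nlinarith) (mul_le_mul_of_nonneg_right hk (by linarith))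
  simpa using integral_cluster_pow_mul_auxCluster_pow_le (P := fun _ _ => True) hs (by linarith)
    (by linarith) (zero_le_one.trans hη) (fun _ _ _ _ _ _ h => h)
    (fun i _ j hj _ => (mul_le_mul_of_nonneg_left (hexp hη hj hm) hs).trans h)
    (fun i hi j _ _ => mul_le_mul_of_nonneg_left (hexp hζ hi hn) (by linarith)) A U

open Classical in
theorem integral_cluster_pow_le_of_le_one (hs : 0 ≤ s) (hζ : 0 ≤ ζ) (hζ1 : ζ ≤ 1) (hb : 0 ≤ b)
    (h : s * cpoissonGF a b ζ ≤ ζ) (A : Finset (Fin m)) (U : Finset (Fin n)) :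
    ∫ B, (if b ≤ (cluster (intersectionGraphVia B A) U)ᶜ.card * (p : ℝ) ∧
        a ≤ (A \ auxCluster B A U).card * (p : ℝ) then
      s ^ (cluster (intersectionGraphVia B A) U).card else 0) ∂bipartiteLaw n m p ≤
        ζ ^ U.card := by
  have hp : 0 ≤ (p : ℝ) := p.2.1
  have hp1 : (p : ℝ) ≤ 1 := p.2.2
  have hη : Real.exp (b * (ζ - 1)) ≤ 1 :=
    Real.exp_le_one_iff.2 (mul_nonpos_of_nonneg_of_nonpos hb (by linarith))
  have hexp : ∀ {k : ℕ} {x c : ℝ}, 0 ≤ x → x ≤ 1 → c ≤ k * (p : ℝ) →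
      (1 + p * (x - 1)) ^ k ≤ Real.exp (c * (x - 1)) := fun {k x c} hx hx1 hk =>
    one_add_mul_pow_le_exp (by nlinarith) (mul_le_mul_of_nonpos_right hk (by linarith))
  simpa using integral_cluster_pow_mul_auxCluster_pow_le (t := 1)
    (P := fun i j => b ≤ i * (p : ℝ) ∧ a ≤ j * (p : ℝ)) hs zero_le_one hζ (Real.exp_pos _).le
    (fun i i' j j' hi hj hij => ⟨hij.1.trans (by gcongr), hij.2.trans (by gcongr)⟩)
    (fun i _ j _ hij =>
      (mul_le_mul_of_nonneg_left (hexp (Real.exp_pos _).le hη hij.2) hs).trans h)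
    (fun i _ j _ hij => (one_mul _).trans_le (hexp hζ hζ1 hij.1)) A U

theorem le_integral_cluster_pow (hs : 0 ≤ s) (hζ : 0 ≤ ζ) (hζ1 : ζ ≤ 1) (hb : 0 ≤ b)
    (hp1 : (p : ℝ) < 1) (hm : m * (p : ℝ) ≤ (1 - p) * a) (hn : n * (p : ℝ) ≤ (1 - p) * b)
    (h : ζ ≤ s * cpoissonGF a b ζ) (A : Finset (Fin m)) (U : Finset (Fin n)) :
    ζ ^ U.card ≤ ∫ B, s ^ (cluster (intersectionGraphVia B A) U).card ∂bipartiteLaw n m p := by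
  have hp : 0 ≤ (p : ℝ) := p.2.1
  have hη : Real.exp (b * (ζ - 1)) ≤ 1 :=
    Real.exp_le_one_iff.2 (mul_nonpos_of_nonneg_of_nonpos hb (by linarith))
  have hexp : ∀ {k l : ℕ} {x c : ℝ}, 0 ≤ x → x ≤ 1 → k ≤ l → l * (p : ℝ) ≤ (1 - p) * c →
      Real.exp (c * (x - 1)) ≤ (1 + p * (x - 1)) ^ k := fun {k l x c} hx hx1 hkl hl =>
    exp_mul_le_one_add_mul_pow hp hp1 (le_trans (by gcongr) hl) (by linarith) (by linarith)
  exact le_integral_cluster_pow_of_subsolution hs hζ (Real.exp_pos _).le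
    (fun j hj => h.trans (mul_le_mul_of_nonneg_left (hexp (Real.exp_pos _).le hη hj hm) hs))
    (fun i hi => hexp hζ hζ1 hi hn) A U

end MomentBounds

section GeneratingFunction

variable {a b s ρ : ℝ}

lemma hasDerivAt_cpoissonGF (a b s : ℝ) :
    HasDerivAt (cpoissonGF a b) (cpoissonGF a b s * (a * (Real.exp (b * (s - 1)) * b))) s := by
  have hlin : HasDerivAt (fun s => b * (s - 1)) b s := by
    simpa using ((hasDerivAt_id s).sub_const 1).const_mul b
  exact ((hlin.exp.sub_const 1).const_mul a).exp

lemma continuous_cpoissonGF : Continuous (cpoissonGF a b) := by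
  unfold cpoissonGF; fun_prop

@[simp] lemma cpoissonGF_one (a b : ℝ) : cpoissonGF a b 1 = 1 := by simp [cpoissonGF]

lemma cpoissonGF_pos (a b s : ℝ) : 0 < cpoissonGF a b s := Real.exp_pos _

lemma strictConvexOn_cpoissonGF (ha : 0 < a) (hb : b ≠ 0) :
    StrictConvexOn ℝ Set.univ (cpoissonGF a b) := by
  refine ⟨convex_univ, fun x _ y _ hxy u w hu hw huw => ?_⟩
  have hne : b * (x - 1) ≠ b * (y - 1) := by simpa [hb] using hxy
  have hinner := strictConvexOn_exp.2 (Set.mem_univ _) (Set.mem_univ _) hne hu hw huw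
  have houter := convexOn_exp.2 (Set.mem_univ (a * (Real.exp (b * (x - 1)) - 1)))
    (Set.mem_univ (a * (Real.exp (b * (y - 1)) - 1))) hu.le hw.le huw
  simp only [smul_eq_mul] at hinner houter ⊢
  have harg : b * (u * x + w * y - 1) = u * (b * (x - 1)) + w * (b * (y - 1)) := by
    linear_combination b * huw
  refine lt_of_lt_of_le (Real.exp_lt_exp.2 ?_) houter
  calc a * (Real.exp (b * (u * x + w * y - 1)) - 1)
      < a * (u * Real.exp (b * (x - 1)) + w * Real.exp (b * (y - 1)) - 1) := by
        rw [harg]; gcongr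
    _ = u * (a * (Real.exp (b * (x - 1)) - 1)) + w * (a * (Real.exp (b * (y - 1)) - 1)) := by
        linear_combination a * huw

lemma tendsto_slope_cpoissonGF_sub_self :
    Tendsto (slope (fun s => cpoissonGF a b s - s) 1) (𝓝[≠] 1) (𝓝 (a * b - 1)) := by
  have h := (hasDerivAt_cpoissonGF a b 1).sub (hasDerivAt_id (1 : ℝ))
  simp only [cpoissonGF_one, sub_self, mul_zero, Real.exp_zero, one_mul] at h
  exact hasDerivAt_iff_tendsto_slope.1 h

lemma exists_gt_one_cpoissonGF_lt (h : a * b < 1) : ∃ s > 1, cpoissonGF a b s < s := by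
  have hslope := (tendsto_slope_cpoissonGF_sub_self.eventually_lt_const (sub_neg.2 h)).filter_mono
    (nhdsGT_le_nhdsNE 1)
  obtain ⟨s, hs, hs1⟩ := (hslope.and self_mem_nhdsWithin).exists
  refine ⟨s, hs1, ?_⟩
  rw [slope_def_field, cpoissonGF_one, sub_self, sub_zero, div_lt_iff₀ (sub_pos.2 hs1)] at hs
  linarith

lemma exists_mem_Ioo_cpoissonGF_lt (h : 1 < a * b) :
    ∃ s ∈ Set.Ioo (0 : ℝ) 1, cpoissonGF a b s < s := by
  have hslope := (tendsto_slope_cpoissonGF_sub_self.eventually_const_lt (sub_pos.2 h)).filter_mono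
    (nhdsLT_le_nhdsNE 1)
  obtain ⟨s, hs, hs01⟩ := (hslope.and (Ioo_mem_nhdsLT zero_lt_one)).exists
  refine ⟨s, hs01, ?_⟩
  rw [slope_def_field, cpoissonGF_one, sub_self, sub_zero,
    lt_div_iff_of_neg (sub_neg.2 hs01.2)] at hs
  linarith

theorem exists_isLeast_fixedPoint (a b : ℝ) :
    ∃ ρ, IsLeast {s : ℝ | 0 ≤ s ∧ s = cpoissonGF a b s} ρ := by
  have hclosed : IsClosed {s : ℝ | 0 ≤ s ∧ s = cpoissonGF a b s} :=
    isClosed_Ici.inter (isClosed_eq continuous_id continuous_cpoissonGF)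
  exact ⟨_, hclosed.isLeast_csInf ⟨1, by simp⟩ ⟨0, fun s hs => hs.1⟩⟩

lemma leastFixedPoint_pos (hρ : IsLeast {s : ℝ | 0 ≤ s ∧ s = cpoissonGF a b s} ρ) : 0 < ρ :=
  hρ.1.2 ▸ cpoissonGF_pos a b ρ

lemma leastFixedPoint_le (hρ : IsLeast {s : ℝ | 0 ≤ s ∧ s = cpoissonGF a b s} ρ) (hs : 0 ≤ s)
    (h : cpoissonGF a b s ≤ s) : ρ ≤ s := by
  obtain ⟨x, hx, hx0⟩ := intermediate_value_Icc' hs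
    (continuous_cpoissonGF.sub continuous_id).continuousOn
    (show (0 : ℝ) ∈ Set.Icc (cpoissonGF a b s - s) (cpoissonGF a b 0 - 0) from
      ⟨by linarith, by simpa using (cpoissonGF_pos a b 0).le⟩)
  exact (hρ.2 ⟨hx.1, (sub_eq_zero.1 hx0).symm⟩).trans hx.2

lemma leastFixedPoint_lt_one (hρ : IsLeast {s : ℝ | 0 ≤ s ∧ s = cpoissonGF a b s} ρ)
    (h : 1 < a * b) : ρ < 1 := by
  obtain ⟨s, hs01, hs⟩ := exists_mem_Ioo_cpoissonGF_lt h
  exact (leastFixedPoint_le hρ hs01.1.le hs.le).trans_lt hs01.2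

lemma lt_cpoissonGF_of_lt_leastFixedPoint (hρ : IsLeast {s : ℝ | 0 ≤ s ∧ s = cpoissonGF a b s} ρ)
    (hs : 0 ≤ s) (hsρ : s < ρ) : s < cpoissonGF a b s := by
  by_contra! h
  exact hsρ.not_ge (leastFixedPoint_le hρ hs h)

lemma cpoissonGF_lt_of_leastFixedPoint_lt (hρ : IsLeast {s : ℝ | 0 ≤ s ∧ s = cpoissonGF a b s} ρ)
    (ha : 0 < a) (hb : b ≠ 0) (hρs : ρ < s) (hs1 : s < 1) : cpoissonGF a b s < s := by
  obtain ⟨u, w, hu, hw, huw, hs⟩ := (Convex.mem_Ioo (hρs.trans hs1)).1 ⟨hρs, hs1⟩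
  have h := (strictConvexOn_cpoissonGF ha hb).2 (Set.mem_univ ρ) (Set.mem_univ 1)
    (hρs.trans hs1).ne hu hw huw
  rw [smul_eq_mul, smul_eq_mul, hs, ← hρ.1.2, cpoissonGF_one] at h
  simpa only [smul_eq_mul, hs] using h

end GeneratingFunction

section ExponentialMarkov

variable {Ω : Type*} [MeasurableSpace Ω] {μ : Measure Ω} {s : ℝ}

lemma measureReal_le_integral_div [IsFiniteMeasure μ] {F : Ω → ℝ} {E : Set Ω} {c : ℝ}
    (hc : 0 < c) (hint : Integrable F μ) (hF : ∀ ω, 0 ≤ F ω) (hE : ∀ ω ∈ E, c ≤ F ω) :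
    μ.real E ≤ (∫ ω, F ω ∂μ) / c := by
  rw [le_div_iff₀' hc]
  exact (mul_le_mul_of_nonneg_left (measureReal_mono hE) hc.le).trans
    (mul_meas_ge_le_integral_of_nonneg (.of_forall hF) hint c)

lemma measureReal_le_mul_rpow_neg [IsFiniteMeasure μ] {X : Ω → ℕ} {Q : Ω → Prop}
    [DecidablePred Q] {K : ℝ} (hs : 1 < s)
    (hint : Integrable (fun ω => if Q ω then s ^ X ω else 0) μ)
    (h : ∫ ω, (if Q ω then s ^ X ω else 0) ∂μ ≤ K) (x : ℝ) :
    μ.real {ω | x ≤ X ω ∧ Q ω} ≤ K * s ^ (-x) := by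
  have hs0 : 0 < s := zero_lt_one.trans hs
  rw [Real.rpow_neg hs0.le, ← div_eq_mul_inv]
  refine (measureReal_le_integral_div (Real.rpow_pos_of_pos hs0 x) hint
    (fun ω => by split_ifs <;> positivity) ?_).trans (by gcongr)
  rintro ω ⟨hx, hQ⟩
  rw [if_pos hQ, ← Real.rpow_natCast]
  exact Real.rpow_le_rpow_of_exponent_le hs.le hx

lemma integral_pow_sub_rpow_le_measureReal [IsProbabilityMeasure μ] {X : Ω → ℕ}
    (hX : Measurable X) (hs : 0 < s) (hs1 : s < 1) (x : ℝ) :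
    ∫ ω, s ^ X ω ∂μ - s ^ x ≤ μ.real {ω | X ω ≤ x} := by
  have hmeas : MeasurableSet {ω | (X ω : ℝ) ≤ x} :=
    measurableSet_le (measurable_from_nat.comp hX) measurable_const
  have hind : Integrable ({ω | (X ω : ℝ) ≤ x}.indicator (1 : Ω → ℝ)) μ :=
    (integrable_const 1).indicator hmeas
  have hle : ∫ ω, s ^ X ω ∂μ ≤ ∫ ω, ({ω | (X ω : ℝ) ≤ x}.indicator 1 ω + s ^ x) ∂μ := by
    refine integral_mono_of_nonneg (.of_forall fun ω => by positivity)
      (hind.add (integrable_const _)) (.of_forall fun ω => ?_)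
    have hsx : 0 < s ^ x := Real.rpow_pos_of_pos hs x
    by_cases hω : (X ω : ℝ) ≤ x
    · have := pow_le_one₀ (n := X ω) hs.le hs1.le
      simp only [Set.indicator, Set.mem_ofPred_eq, hω, if_true, Pi.one_apply]
      linarith
    · simp only [Set.indicator, Set.mem_ofPred_eq, hω, if_false, zero_add]
      rw [← Real.rpow_natCast]
      exact Real.rpow_le_rpow_of_exponent_ge hs hs1.le (not_le.1 hω).le
  rw [integral_add hind (integrable_const _), integral_indicator_one hmeas, integral_const,
    probReal_univ, one_smul] at hle
  linarith

end ExponentialMarkov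

section Tails

variable {a b ζ x : ℝ}

theorem exists_card_cluster_tail (hb : 0 ≤ b) (h : a * b < 1) :
    ∃ K : ℝ, ∃ s > 1, ∀ {n m : ℕ} {p : unitInterval}, m * (p : ℝ) ≤ a → n * (p : ℝ) ≤ b →
      ∀ (A : Finset (Fin m)) (v : Fin n) (x : ℝ),
        (bipartiteLaw n m p).real
          {B | x ≤ (cluster (intersectionGraphVia B A) {v}).card} ≤ K * s ^ (-x) := by
  obtain ⟨ζ, hζ, hgζ⟩ := exists_gt_one_cpoissonGF_lt h
  have hs : 1 < ζ / cpoissonGF a b ζ := (one_lt_div (cpoissonGF_pos _ _ _)).2 hgζ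
  refine ⟨ζ, ζ / cpoissonGF a b ζ, hs, fun {n m p} hm hn A v x => ?_⟩
  have hmoment := integral_cluster_pow_mul_auxCluster_pow_le_of_one_le (t := 1)
    (zero_lt_one.trans hs).le le_rfl hζ.le hb hm hn
    (by rw [one_mul]; exact (div_mul_cancel₀ _ (cpoissonGF_pos _ _ _).ne').le) A {v}
  simpa using measureReal_le_mul_rpow_neg (Q := fun _ => True) hs .of_finite
    (by simpa using hmoment) x

lemma exists_supersolution (h : cpoissonGF a b ζ < ζ) :
    ∃ x ∈ Set.Ioo (0 : ℝ) 1, (1 + x) * cpoissonGF ((1 - x) * a) ((1 - x) * b) ζ ≤ ζ := by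
  have hcont : Continuous fun x : ℝ => (1 + x) * cpoissonGF ((1 - x) * a) ((1 - x) * b) ζ := by
    unfold cpoissonGF; fun_prop
  have hlt := ((hcont.tendsto 0).eventually_lt_const (u := ζ) (by simpa)).filter_mono
    (nhdsWithin_le_nhds (s := Set.Ioi 0))
  obtain ⟨x, hx, hx01⟩ := (hlt.and (Ioo_mem_nhdsGT zero_lt_one)).exists
  exact ⟨x, hx01, hx.le⟩

lemma exists_subsolution (h : ζ < cpoissonGF a b ζ) :
    ∃ x ∈ Set.Ioo (0 : ℝ) 1, ζ ≤ (1 - x) * cpoissonGF ((1 + x) * a) ((1 + x) * b) ζ := by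
  have hcont : Continuous fun x : ℝ => (1 - x) * cpoissonGF ((1 + x) * a) ((1 + x) * b) ζ := by
    unfold cpoissonGF; fun_prop
  have hlt := ((hcont.tendsto 0).eventually_const_lt (u := ζ) (by simpa)).filter_mono
    (nhdsWithin_le_nhds (s := Set.Ioi 0))
  obtain ⟨x, hx, hx01⟩ := (hlt.and (Ioo_mem_nhdsGT zero_lt_one)).exists
  exact ⟨x, hx01, hx.le⟩

theorem exists_card_auxCluster_tail (ha : 0 ≤ a) (hb : 0 ≤ b) (hx : 0 < x) :
    ∃ δ > (0 : ℝ), ∃ c > (0 : ℝ), ∀ {n m : ℕ} {p : unitInterval},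
      m * (p : ℝ) ≤ a → n * (p : ℝ) ≤ b → ∀ (A : Finset (Fin m)) (U : Finset (Fin n)),
        (bipartiteLaw n m p).real {B | (cluster (intersectionGraphVia B A) U).card ≤ δ * n ∧
          x * n ≤ (auxCluster B A U).card} ≤ 2 ^ U.card * Real.exp (-(c * n)) := by
  set M := a * (2 * Real.exp b - 1) with hM
  have hM0 : 0 ≤ M := mul_nonneg ha (by linarith [Real.one_le_exp hb])
  have hlog : 0 < Real.log 2 := Real.log_pos one_lt_two
  set c := x * Real.log 2 / 2 with hc
  have hδM : c / (M + 1) * M ≤ c := by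
    rw [div_mul_eq_mul_div, div_le_iff₀ (by positivity)]
    have : 0 < c := by positivity
    nlinarith
  refine ⟨c / (M + 1), by positivity, c, by positivity, fun {n m p} hm hn A U => ?_⟩
  have hmoment := integral_cluster_pow_mul_auxCluster_pow_le_of_one_le (s := Real.exp (-M))
    (t := 2) (ζ := 2) (Real.exp_pos _).le one_le_two one_le_two hb hm hn
    (by rw [show b * (2 - 1) = b by ring, ← hM, ← Real.exp_add]; simp) A U
  rw [Real.exp_neg (c * n), ← div_eq_mul_inv]
  refine (measureReal_le_integral_div (Real.exp_pos (c * n)) .of_finite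
    (fun B => by positivity) ?_).trans (div_le_div_of_nonneg_right hmoment (Real.exp_pos _).le)
  rintro B ⟨hcluster, haux⟩
  rw [← Real.exp_nat_mul, ← Real.exp_log two_pos, ← Real.exp_nat_mul, ← Real.exp_add]
  refine Real.exp_le_exp.2 ?_
  have hn0 : (0 : ℝ) ≤ n := n.cast_nonneg
  have hcn : 2 * (c * n) = x * n * Real.log 2 := by rw [hc]; ring
  linarith [mul_le_mul_of_nonneg_right haux hlog.le, mul_le_mul_of_nonneg_right hcluster hM0,
    mul_le_mul_of_nonneg_right hδM hn0]

/-- Outside the rare event that few vertices have many auxiliary neighbours, a cluster of at most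
`δ * n` vertices leaves enough of both parts unexplored for the supersolution to survive the
truncation of the moment bound. -/
theorem exists_card_cluster_gap (ha : 0 < a) (hb : 0 < b) (hζ : 0 ≤ ζ) (hζ1 : ζ ≤ 1)
    (h : cpoissonGF a b ζ < ζ) :
    ∃ δ > (0 : ℝ), ∃ s > 1, ∃ c > (0 : ℝ), ∃ a₀ < a, ∀ {n m : ℕ} {p : unitInterval},
      m * (p : ℝ) ≤ a → n * (p : ℝ) = b → ∀ {A : Finset (Fin m)}, a₀ ≤ A.card * (p : ℝ) →
      ∀ (U : Finset (Fin n)) (x : ℝ),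
        (bipartiteLaw n m p).real {B | x ≤ (cluster (intersectionGraphVia B A) U).card ∧
          (cluster (intersectionGraphVia B A) U).card ≤ δ * n} ≤
            ζ ^ U.card * s ^ (-x) + 2 ^ U.card * Real.exp (-(c * n)) := by
  classical
  obtain ⟨y, ⟨hy0, hy1⟩, hy⟩ := exists_supersolution h
  obtain ⟨δ, hδ, c, hc, haux⟩ := exists_card_auxCluster_tail (x := y / 2 * a / b) ha.le hb.le
    (by positivity)
  refine ⟨min δ y, lt_min hδ hy0, 1 + y, by linarith, c, hc, (1 - y / 2) * a, by nlinarith,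
    fun {n m p} hm hn {A} hA U x => ?_⟩
  have hmoment := measureReal_le_mul_rpow_neg (s := 1 + y) (by linarith) .of_finite
    (integral_cluster_pow_le_of_le_one (p := p) (a := (1 - y) * a) (b := (1 - y) * b)
      (by linarith) hζ hζ1 (mul_nonneg (by linarith) hb.le) hy A U) x
  refine (measureReal_mono fun B hB => ?_).trans ((measureReal_union_le _ _).trans
    (add_le_add hmoment (haux hm hn.le A U)))
  obtain ⟨hx, hsmall⟩ := hB
  have hp : 0 ≤ (p : ℝ) := p.2.1
  rcases le_or_gt (y / 2 * a / b * n) (auxCluster B A U).card with hlarge | hfew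
  · exact .inr ⟨hsmall.trans (by gcongr; exact min_le_left _ _), hlarge⟩
  · refine .inl ⟨hx, ?_, ?_⟩
    · rw [Finset.card_compl, Nat.cast_sub (Finset.card_le_univ _), Fintype.card_fin, ← hn,
        ← mul_assoc]
      have : min δ y * n ≤ y * n := by gcongr; exact min_le_right _ _
      gcongr
      linarith
    · rw [Finset.card_sdiff_of_subset (auxCluster_subset B A U),
        Nat.cast_sub (Finset.card_le_card (auxCluster_subset B A U))]
      have : (auxCluster B A U).card * (p : ℝ) ≤ y / 2 * a := by
        calc (auxCluster B A U).card * (p : ℝ) ≤ y / 2 * a / b * n * p := by gcongr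
          _ = y / 2 * a := by rw [mul_assoc, hn]; field_simp
      rw [sub_mul]
      linarith

theorem exists_le_measureReal_card_cluster_le (ha : 0 ≤ a) (hb : 0 ≤ b) (hζ : 0 ≤ ζ)
    (hζ1 : ζ ≤ 1) (h : ζ < cpoissonGF a b ζ) :
    ∃ s, 0 < s ∧ s < 1 ∧ ∃ p₀ > 0, ∀ {n m : ℕ} {p : unitInterval}, (p : ℝ) ≤ p₀ →
      m * (p : ℝ) ≤ a → n * (p : ℝ) ≤ b → ∀ (A : Finset (Fin m)) (v : Fin n) (x : ℝ),
        ζ - s ^ x ≤ (bipartiteLaw n m p).real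
          {B | (cluster (intersectionGraphVia B A) {v}).card ≤ x} := by
  obtain ⟨y, ⟨hy0, hy1⟩, hy⟩ := exists_subsolution h
  refine ⟨1 - y, by linarith, by linarith, y / (1 + y), by positivity,
    fun {n m p} hp hm hn A v x => ?_⟩
  have hp1 : y / (1 + y) < 1 := (div_lt_one (by linarith)).2 (by linarith)
  have hscale : 1 ≤ (1 - (p : ℝ)) * (1 + y) := by
    rw [le_div_iff₀ (by linarith)] at hp
    linarith
  have hmoment := le_integral_cluster_pow (U := {v}) (by linarith) hζ hζ1 (by positivity)
    (hp.trans_lt hp1)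
    (hm.trans (by rw [← mul_assoc]; exact le_mul_of_one_le_left ha hscale))
    (hn.trans (by rw [← mul_assoc]; exact le_mul_of_one_le_left hb hscale)) hy A
  rw [Finset.card_singleton, pow_one] at hmoment
  exact (sub_le_sub_right hmoment _).trans (integral_pow_sub_rpow_le_measureReal
    (X := fun B => (cluster (intersectionGraphVia B A) {v}).card) .of_discrete (by linarith)
    (by linarith) x)

end Tails

section SecondMoment

variable {Ω ι : Type*} [MeasurableSpace Ω] {μ : Measure Ω} [IsProbabilityMeasure μ] [Fintype ι]
  {E : ι → Set Ω} {a b c ε ρ : ℝ}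

lemma sum_sum_measureReal_inter_le (hb : 0 ≤ b)
    (hab : Pairwise fun i j => μ.real (E i ∩ E j) ≤ b) :
    ∑ i, ∑ j, μ.real (E i ∩ E j) ≤ Fintype.card ι + Fintype.card ι ^ 2 * b := by
  classical
  calc ∑ i, ∑ j, μ.real (E i ∩ E j) ≤ ∑ i : ι, ∑ j : ι, ((if i = j then 1 else 0) + b) := by
        refine Finset.sum_le_sum fun i _ => Finset.sum_le_sum fun j _ => ?_
        obtain rfl | hij := eq_or_ne i j
        · rw [if_pos rfl]
          exact measureReal_le_one.trans (le_add_of_nonneg_right hb)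
        · rw [if_neg hij, zero_add]
          exact hab hij
    _ = Fintype.card ι + Fintype.card ι ^ 2 * b := by
        simp only [Finset.sum_add_distrib, Finset.sum_ite_eq, Finset.mem_univ, ↓reduceIte,
          Finset.sum_const, Finset.card_univ, nsmul_eq_mul, mul_one, add_right_inj]
        ring

lemma integral_sq_sum_indicator_sub_le (hE : ∀ i, MeasurableSet (E i)) (ha : ∀ i, a ≤ μ.real (E i))
    (hb : 0 ≤ b) (hab : Pairwise fun i j => μ.real (E i ∩ E j) ≤ b) (hc : 0 ≤ c) :
    ∫ ω, (∑ i, (E i).indicator 1 ω - c) ^ 2 ∂μ ≤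
      Fintype.card ι + Fintype.card ι ^ 2 * b - 2 * c * (Fintype.card ι * a) + c ^ 2 := by
  have hint : ∀ {F : Set Ω}, MeasurableSet F → Integrable (F.indicator (1 : Ω → ℝ)) μ := fun hF =>
    (integrable_const 1).indicator hF
  have hpair : ∀ i j, Integrable ((E i ∩ E j).indicator (1 : Ω → ℝ)) μ := fun i j =>
    hint ((hE i).inter (hE j))
  have hexpand : ∀ ω, (∑ i, (E i).indicator (1 : Ω → ℝ) ω - c) ^ 2 =
      ∑ i, ∑ j, (E i ∩ E j).indicator 1 ω - 2 * c * ∑ i, (E i).indicator 1 ω + c ^ 2 := fun ω => by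
    simp only [Set.inter_indicator_one, Pi.mul_apply, ← Finset.sum_mul_sum]
    ring
  have hmean : Fintype.card ι * a ≤ ∑ i, μ.real (E i) := by
    simpa using Finset.card_nsmul_le_sum Finset.univ (fun i => μ.real (E i)) a fun i _ => ha i
  have hcorr := sum_sum_measureReal_inter_le hb hab
  have hsum : Integrable (fun ω => ∑ i, (E i).indicator (1 : Ω → ℝ) ω) μ :=
    integrable_finsetSum _ fun i _ => hint (hE i)
  have hsums : ∀ i, Integrable (fun ω => ∑ j, (E i ∩ E j).indicator (1 : Ω → ℝ) ω) μ := fun i =>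
    integrable_finsetSum _ fun j _ => hpair i j
  have hdouble : Integrable
      (fun ω => ∑ i, ∑ j, (E i ∩ E j).indicator (1 : Ω → ℝ) ω - 2 * c * ∑ i, (E i).indicator 1 ω)
      μ := (integrable_finsetSum _ fun i _ => hsums i).sub (hsum.const_mul _)
  simp only [hexpand]
  rw [integral_add hdouble (integrable_const _),
    integral_sub (integrable_finsetSum _ fun i _ => hsums i) (hsum.const_mul _),
    integral_const_mul, integral_finsetSum _ fun i _ => hsums i,
    integral_finsetSum _ fun i _ => hint (hE i)]
  simp only [integral_finsetSum _ fun j _ => hpair _ j, integral_indicator_one (hE _),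
    integral_indicator_one ((hE _).inter (hE _)), integral_const, probReal_univ, one_smul]
  linarith [mul_le_mul_of_nonneg_left hmean (mul_nonneg zero_le_two hc)]

theorem measureReal_le_abs_sum_indicator_sub_le [Nonempty ι] (hE : ∀ i, MeasurableSet (E i))
    (ha : ∀ i, a ≤ μ.real (E i)) (hb : 0 ≤ b) (hab : Pairwise fun i j => μ.real (E i ∩ E j) ≤ b)
    (hρ : 0 ≤ ρ) (hε : 0 < ε) :
    μ.real {ω | ε * Fintype.card ι ≤ |∑ i, (E i).indicator 1 ω - ρ * Fintype.card ι|} ≤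
      (1 / Fintype.card ι + b - 2 * ρ * a + ρ ^ 2) / ε ^ 2 := by
  have hk : (0 : ℝ) < Fintype.card ι := by exact_mod_cast Fintype.card_pos
  have hsum : Measurable fun ω => ∑ i, (E i).indicator (1 : Ω → ℝ) ω :=
    Finset.measurable_fun_sum _ fun i _ => measurable_one.indicator (hE i)
  have hbound : ∀ ω, ‖(∑ i, (E i).indicator (1 : Ω → ℝ) ω - ρ * Fintype.card ι) ^ 2‖ ≤
      (Fintype.card ι + ρ * Fintype.card ι) ^ 2 := fun ω => by
    have h0 : 0 ≤ ∑ i, (E i).indicator (1 : Ω → ℝ) ω :=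
      Finset.sum_nonneg fun i _ => Set.indicator_nonneg (fun _ _ => zero_le_one) ω
    have h1 : ∑ i, (E i).indicator (1 : Ω → ℝ) ω ≤ Fintype.card ι := by
      simpa using Finset.sum_le_card_nsmul Finset.univ (fun i => (E i).indicator (1 : Ω → ℝ) ω) 1
        fun i _ => Set.indicator_le_self' (fun _ _ => zero_le_one) ω
    rw [Real.norm_eq_abs, abs_pow]
    refine pow_le_pow_left₀ (abs_nonneg _) (abs_le.2 ⟨?_, ?_⟩) 2 <;> nlinarith
  have hmarkov := measureReal_le_integral_div (μ := μ)
    (E := {ω | ε * Fintype.card ι ≤ |∑ i, (E i).indicator 1 ω - ρ * Fintype.card ι|})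
    (F := fun ω => (∑ i, (E i).indicator 1 ω - ρ * Fintype.card ι) ^ 2)
    (c := (ε * Fintype.card ι) ^ 2) (by positivity)
    (.of_bound ((hsum.sub_const _).pow_const 2).aestronglyMeasurable _ (.of_forall hbound))
    (fun ω => sq_nonneg _)
    fun ω hω => (pow_le_pow_left₀ (by positivity) hω 2).trans_eq (sq_abs _)
  refine hmarkov.trans ((div_le_div_of_nonneg_right (integral_sq_sum_indicator_sub_le hE ha hb hab
    (by positivity)) (by positivity)).trans_eq ?_)
  field_simp

end SecondMoment

section Sprinkling

variable {n m : ℕ} {p : unitInterval} {A : Finset (Fin m)} {S T : Finset (Fin n)} {a : Fin m}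
  {B : Bipartite n m} {d : ℝ}

/-- The event that the auxiliary vertex `a` has a neighbour in `S`. -/
def hits (S : Finset (Fin n)) (a : Fin m) : Set (Bipartite n m) :=
  {B | ∃ v ∈ S, B (v, a) = true}

lemma mem_hits : B ∈ hits S a ↔ ∃ v ∈ S, B (v, a) = true := Iff.rfl

lemma dependsOn_hits : DependsOn (· ∈ hits (n := n) S a) {e | e.1 ∈ S ∧ e.2 = a} :=
  fun B B' h => propext <| exists_congr fun v => and_congr_right fun hv => by
    rw [h (v, a) ⟨hv, rfl⟩]

lemma dependsOn_mem_hits_inter : DependsOn (· ∈ hits (n := n) S a ∩ hits T a) {e | e.2 = a} :=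
  fun _ _ h => congrArg₂ And (dependsOn_hits fun e he => h e he.2)
    (dependsOn_hits fun e he => h e he.2)

lemma measureReal_hits (S : Finset (Fin n)) (a : Fin m) :
    (bipartiteLaw n m p).real (hits S a) = 1 - (1 - p) ^ S.card := by
  have hcompl : (hits S a)ᶜ = ⋂ v ∈ S, {B : Bipartite n m | B (v, a) = true}ᶜ := by
    ext B
    simp [mem_hits]
  have hmiss : (bipartiteLaw n m p).real (hits S a)ᶜ = (1 - p) ^ S.card := by
    rw [hcompl]
    refine (measureReal_biInter_of_dependsOn S (S := fun v => {(v, a)}) (fun v w hvw => ?_)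
      fun v B B' h => ?_).trans (Finset.prod_eq_pow_card fun v _ => ?_)
    · simpa using hvw
    · simp [h (v, a) rfl]
    · exact (probReal_compl_eq_one_sub (Set.toFinite _).measurableSet).trans
        (by rw [← bipartiteLaw_real_edge (v, a)]; rfl)
  rw [probReal_compl_eq_one_sub (Set.toFinite _).measurableSet] at hmiss
  linarith

lemma measureReal_hits_inter (hST : Disjoint S T) (a : Fin m) :
    (bipartiteLaw n m p).real (hits S a ∩ hits T a) =
      (1 - (1 - p) ^ S.card) * (1 - (1 - p) ^ T.card) := by
  rw [← measureReal_hits S a, ← measureReal_hits T a]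
  exact measureReal_inter_of_dependsOn
    (Set.disjoint_left.2 fun e he he' => Finset.disjoint_left.1 hST he.1 he'.1)
    dependsOn_hits dependsOn_hits

lemma measureReal_forall_not_hits_inter (D : Finset (Fin m)) (hST : Disjoint S T) :
    (bipartiteLaw n m p).real (⋂ a ∈ D, (hits S a ∩ hits T a)ᶜ) =
      (1 - (1 - (1 - p) ^ S.card) * (1 - (1 - p) ^ T.card)) ^ D.card := by
  have hcolumns :
      Pairwise (Function.onFun Disjoint fun a : Fin m => {e : Fin n × Fin m | e.2 = a}) :=
    fun a b hab => Set.disjoint_left.2 fun e he he' => hab (Eq.trans (Eq.symm he) he')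
  have hdep : ∀ a : Fin m, DependsOn (· ∈ (hits (n := n) S a ∩ hits T a)ᶜ) {e | e.2 = a} :=
    fun a B B' h => congrArg Not (dependsOn_mem_hits_inter h)
  have hprod := measureReal_biInter_of_dependsOn
    (μ := fun _ : Fin n × Fin m => bernoulliMeasure true false p) D hcolumns hdep
  refine hprod.trans (Finset.prod_eq_pow_card fun a _ => ?_)
  rw [← measureReal_hits_inter hST a]
  exact probReal_compl_eq_one_sub (Set.toFinite _).measurableSet

lemma measureReal_forall_not_hits_inter_le (D : Finset (Fin m)) (hST : Disjoint S T) (hd : 0 ≤ d)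
    (hS : d ≤ S.card) (hT : d ≤ T.card) :
    (bipartiteLaw n m p).real (⋂ a ∈ D, (hits S a ∩ hits T a)ᶜ) ≤
      (1 - (1 - Real.exp (-(p * d))) ^ 2) ^ D.card := by
  have hp : 0 ≤ (p : ℝ) := p.2.1
  have hp1 : 0 ≤ 1 - (p : ℝ) := sub_nonneg.2 p.2.2
  have hr1 : Real.exp (-(p * d)) ≤ 1 := Real.exp_le_one_iff.2 (neg_nonpos.2 (mul_nonneg hp hd))
  have hpow : ∀ {k : ℕ}, d ≤ k → (1 - (p : ℝ)) ^ k ≤ Real.exp (-(p * d)) := fun {k} hk => by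
    calc (1 - (p : ℝ)) ^ k ≤ Real.exp (-p) ^ k :=
          pow_le_pow_left₀ hp1 (Real.one_sub_le_exp_neg _) k
      _ = Real.exp (-(p * k)) := by rw [← Real.exp_nat_mul]; ring_nf
      _ ≤ Real.exp (-(p * d)) := by gcongr
  have hpow1 : ∀ k : ℕ, (1 - (p : ℝ)) ^ k ≤ 1 := fun k => pow_le_one₀ hp1 (by linarith)
  rw [measureReal_forall_not_hits_inter D hST, sq]
  gcongr
  · nlinarith [hpow1 S.card, hpow1 T.card, pow_nonneg hp1 S.card, pow_nonneg hp1 T.card]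
  · linarith [hpow1 S.card]
  · exact hpow hS
  · exact hpow hT

lemma disjoint_cluster_of_notMem {v w : Fin n} (h : w ∉ cluster (intersectionGraph B) {v}) :
    Disjoint (cluster (intersectionGraphVia B A) {v}) (cluster (intersectionGraphVia B A) {w}) := by
  refine Finset.disjoint_left.2 fun x hv hw => h ?_
  rw [mem_cluster_singleton] at *
  rw [← intersectionGraphVia_univ]
  exact (hv.trans hw.symm).mono (intersectionGraphVia_mono A.subset_univ)

lemma notMem_hits_cluster_inter {v w : Fin n} (h : w ∉ cluster (intersectionGraph B) {v}) :
    B ∉ hits (cluster (intersectionGraphVia B A) {v}) a ∩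
      hits (cluster (intersectionGraphVia B A) {w}) a := by
  rintro ⟨⟨x, hx, hxa⟩, y, hy, hya⟩
  have hle : intersectionGraphVia B A ≤ intersectionGraphVia B Finset.univ :=
    intersectionGraphVia_mono A.subset_univ
  rw [mem_cluster_singleton] at *
  rw [← intersectionGraphVia_univ] at h
  exact h (((hx.mono hle).trans (reachable_of_common_neighbor (Finset.mem_univ a) hxa hya)).trans
    (hy.symm.mono hle))

/-- The clusters of `v` and `w` via `A` are independent of the edges at the other auxiliary
vertices, each of which joins two given large clusters with probability bounded below. -/
theorem measureReal_large_clusters_not_joined_le (A : Finset (Fin m)) (v w : Fin n) (hd : 0 ≤ d) :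
    (bipartiteLaw n m p).real {B | d ≤ (cluster (intersectionGraphVia B A) {v}).card ∧
      d ≤ (cluster (intersectionGraphVia B A) {w}).card ∧
        w ∉ cluster (intersectionGraph B) {v}} ≤
      (1 - (1 - Real.exp (-(p * d))) ^ 2) ^ (Aᶜ).card := by
  let X : Bipartite n m → Finset (Fin n) × Finset (Fin n) := fun B =>
    (cluster (intersectionGraphVia B A) {v}, cluster (intersectionGraphVia B A) {w})
  let E : Finset (Fin n) × Finset (Fin n) → Set (Bipartite n m) := fun N =>
    {B | d ≤ N.1.card ∧ d ≤ N.2.card ∧ Disjoint N.1 N.2 ∧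
      B ∈ ⋂ a ∈ Aᶜ, (hits N.1 a ∩ hits N.2 a)ᶜ}
  have hX : DependsOn X {e | e.2 ∈ A} := fun B B' h => by
    simp only [X, dependsOn_intersectionGraphVia h]
  have hE : ∀ N, DependsOn (· ∈ E N) {e | e.2 ∈ Aᶜ} := fun N B B' h => by
    simp only [E, Set.mem_ofPred_eq, Set.mem_iInter, eq_iff_iff]
    refine and_congr_right fun _ => and_congr_right fun _ => and_congr_right fun _ =>
      forall₂_congr fun a ha => not_congr (iff_of_eq (dependsOn_mem_hits_inter fun e he => h e ?_))
    rwa [Set.mem_ofPred_eq, show e.2 = a from he]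
  have hq : ∀ N, (bipartiteLaw n m p).real (E N) ≤
      (1 - (1 - Real.exp (-(p * d))) ^ 2) ^ (Aᶜ).card := fun N => by
    by_cases hN : d ≤ N.1.card ∧ d ≤ N.2.card ∧ Disjoint N.1 N.2
    · exact (measureReal_mono fun B hB => hB.2.2.2).trans
        (measureReal_forall_not_hits_inter_le Aᶜ hN.2.2 hd hN.1 hN.2.1)
    · have hempty : E N = ∅ := Set.eq_empty_of_forall_notMem fun B hB =>
        hN ⟨hB.1, hB.2.1, hB.2.2.1⟩
      have := Real.exp_le_one_iff.2 (neg_nonpos.2 (mul_nonneg p.2.1 hd))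
      have hexp := Real.exp_pos (-(p * d))
      rw [hempty, measureReal_empty]
      exact pow_nonneg (by nlinarith) _
  have hdisj : Disjoint {e : Fin n × Fin m | e.2 ∈ A} {e | e.2 ∈ Aᶜ} :=
    Set.disjoint_left.2 fun e he he' => Finset.mem_compl.1 he' he
  refine (measureReal_mono fun B hB => ?_).trans
    (measureReal_comp_le_of_dependsOn hdisj hX hE hq)
  exact ⟨hB.1, hB.2.1, disjoint_cluster_of_notMem hB.2.2,
    Set.mem_iInter₂.2 fun a _ => notMem_hits_cluster_inter hB.2.2⟩

end Sprinkling
section Giant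

lemma kthLargestSize_one {V : Type*} [Finite V] {G : SimpleGraph V} {c : G.ConnectedComponent}
    (hc : ∀ c' : G.ConnectedComponent, componentSize c' ≤ componentSize c) :
    kthLargestSize G 1 = componentSize c := by
  refine IsGreatest.csSup_eq ⟨?_, fun s hs => ?_⟩
  · exact (Set.ncard_pos (Set.toFinite _)).2 ⟨c, (le_rfl : componentSize c ≤ componentSize c)⟩
  · obtain ⟨c', hc'⟩ := (Set.ncard_pos (Set.toFinite _)).1 hs
    exact (show s ≤ componentSize c' from hc').trans (hc c')

variable {V : Type*} [Fintype V] {G H : SimpleGraph V} {v w : V} {L d ρ θ ε : ℝ}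

open Classical in
/-- The vertices of the connected components of `G` with at most `x` vertices. -/
noncomputable def smallVertices (G : SimpleGraph V) (x : ℝ) : Finset V :=
  Finset.univ.filter fun v => ((cluster G {v}).card : ℝ) ≤ x

lemma mem_smallVertices : v ∈ smallVertices G L ↔ ((cluster G {v}).card : ℝ) ≤ L := by
  simp [smallVertices]

lemma notMem_smallVertices : v ∉ smallVertices G L ↔ L < (cluster G {v}).card := by
  rw [mem_smallVertices, not_le]

lemma smallVertices_anti (h : G ≤ H) : smallVertices H L ⊆ smallVertices G L := fun _ hv =>
  mem_smallVertices.2 ((Nat.cast_le.2 (Finset.card_le_card (cluster_mono h))).trans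
    (mem_smallVertices.1 hv))

lemma mem_smallVertices_congr (h : G.Reachable v w) :
    v ∈ smallVertices G L ↔ w ∈ smallVertices G L := by
  rw [mem_smallVertices, mem_smallVertices, cluster_eq_of_reachable h]

/-- The graph `G` has exactly one connected component with more than `L` vertices, and the
proportion of the vertices in this component is within `ε` of `θ`. -/
def HasGiant (G : SimpleGraph V) (L θ ε : ℝ) : Prop :=
  ∃ c : G.ConnectedComponent, L < componentSize c ∧
    (∀ c' : G.ConnectedComponent, c' ≠ c → (componentSize c' : ℝ) ≤ L) ∧
    |(componentSize c : ℝ) / Fintype.card V - θ| < ε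

lemma HasGiant.mono {ε' : ℝ} (h : HasGiant G L θ ε) (hε : ε ≤ ε') : HasGiant G L θ ε' := by
  obtain ⟨c, hc, hother, hθ⟩ := h
  exact ⟨c, hc, hother, hθ.trans_le hε⟩

lemma HasGiant.existsUnique (h : HasGiant G L θ ε) :
    ∃! c : G.ConnectedComponent, L < componentSize c := by
  obtain ⟨c, hc, hother, -⟩ := h
  exact ⟨c, hc, fun c' hc' => by_contra fun hne => (hother c' hne).not_gt hc'⟩

lemma HasGiant.abs_kthLargestSize_one_sub_lt (h : HasGiant G L θ ε) :
    |(kthLargestSize G 1 : ℝ) / Fintype.card V - θ| < ε := by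
  obtain ⟨c, hc, hother, hθ⟩ := h
  have hmax : ∀ c' : G.ConnectedComponent, componentSize c' ≤ componentSize c := fun c' => by
    obtain rfl | hne := eq_or_ne c' c
    · exact le_rfl
    · exact_mod_cast (hother c' hne).trans hc.le
  rwa [kthLargestSize_one hmax]

lemma HasGiant.kthLargestSize_two_le (h : HasGiant G L θ ε) (hL : 0 ≤ L) :
    (kthLargestSize G 2 : ℝ) ≤ L := by
  obtain ⟨c, -, hother, -⟩ := h
  refine le_trans (Nat.cast_le.2 (csSup_le' fun s hs => ?_)) (Nat.floor_le hL)
  obtain ⟨c₁, hc₁, c₂, hc₂, hne⟩ := (Set.one_lt_ncard (Set.toFinite _)).1 hs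
  obtain ⟨c', hs', hc'⟩ : ∃ c' : G.ConnectedComponent, s ≤ componentSize c' ∧ c' ≠ c := by
    obtain rfl | h₁ := eq_or_ne c₁ c
    · exact ⟨c₂, hc₂, hne.symm⟩
    · exact ⟨c₁, hc₁, h₁⟩
  exact Nat.le_floor ((Nat.cast_le.2 hs').trans (hother c' hc'))

lemma hasGiant_of_forall_reachable
    (hreach : ∀ v w, v ∉ smallVertices G L → w ∉ smallVertices G L → G.Reachable v w)
    (hρ : ρ + ε ≤ 1)
    (hsmall : |((smallVertices G L).card : ℝ) - ρ * Fintype.card V| < ε * Fintype.card V) :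
    HasGiant G L (1 - ρ) ε := by
  classical
  have hlt : ((smallVertices G L).card : ℝ) < Fintype.card V := by
    nlinarith [(abs_lt.1 hsmall).2, Nat.cast_nonneg (α := ℝ) (Fintype.card V)]
  have hV : (0 : ℝ) < Fintype.card V := (Nat.cast_nonneg _).trans_lt hlt
  obtain ⟨v, -, hv⟩ := Finset.exists_mem_notMem_of_card_lt_card (t := Finset.univ)
    (Nat.cast_lt.1 hlt)
  have hcompl : cluster G {v} = (smallVertices G L)ᶜ := by
    ext w
    rw [mem_cluster_singleton, Finset.mem_compl]
    exact ⟨fun hvw => (mem_smallVertices_congr hvw).not.1 hv, hreach v w hv⟩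
  refine ⟨G.connectedComponentMk v, ?_, fun c' hc' => ?_, ?_⟩
  · rw [componentSize_mk]
    exact notMem_smallVertices.1 hv
  · induction c' using SimpleGraph.ConnectedComponent.ind with | _ w =>
    rw [componentSize_mk]
    by_contra! hw
    exact hc' (SimpleGraph.ConnectedComponent.eq.2 (hreach w v (notMem_smallVertices.2 hw) hv))
  · have hsub : ((Fintype.card V - (smallVertices G L).card : ℝ)) / Fintype.card V - (1 - ρ) =
        -(((smallVertices G L).card - ρ * Fintype.card V) / Fintype.card V) := by
      field_simp
      ring
    rwa [componentSize_mk, hcompl, Finset.card_compl, Nat.cast_sub (Finset.card_le_univ _), hsub,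
      abs_neg, abs_div, abs_of_pos hV, div_lt_iff₀ hV]

lemma exists_reachable_notMem_smallVertices (hGH : G ≤ H) (hw : w ∉ smallVertices H L)
    (hcard : (smallVertices G L).card < (smallVertices H L).card + (cluster H {w}).card) :
    ∃ x, H.Reachable w x ∧ x ∉ smallVertices G L := by
  classical
  by_contra! hall
  have hdisj : Disjoint (smallVertices H L) (cluster H {w}) := Finset.disjoint_right.2 fun x hx =>
    (mem_smallVertices_congr (mem_cluster_singleton.1 hx)).not.1 hw
  have hunion : smallVertices H L ∪ cluster H {w} ⊆ smallVertices G L :=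
    Finset.union_subset (smallVertices_anti hGH) fun x hx => hall x (mem_cluster_singleton.1 hx)
  have hle := Finset.card_le_card hunion
  rw [Finset.card_union_of_disjoint hdisj] at hle
  exact hle.not_gt hcard

/-- A large component of `H` has more than `d ≥ 2 ε |V|` vertices, which is more than the number of
vertices that become large on passing from `G` to `H`. Hence it contains a large component
of `G`, and these are all connected to each other in `H`. -/
theorem hasGiant_of_le (hGH : G ≤ H) (hd : 2 * ε * Fintype.card V ≤ d) (hρ : ρ + ε ≤ 1)
    (hG : ∀ v, L < (cluster G {v}).card → d ≤ (cluster G {v}).card)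
    (hH : ∀ v, L < (cluster H {v}).card → d ≤ (cluster H {v}).card)
    (hsmallG : |((smallVertices G L).card : ℝ) - ρ * Fintype.card V| < ε * Fintype.card V)
    (hsmallH : |((smallVertices H L).card : ℝ) - ρ * Fintype.card V| < ε * Fintype.card V)
    (hjoin : ∀ v w, d ≤ (cluster G {v}).card → d ≤ (cluster G {w}).card → H.Reachable v w) :
    HasGiant H L (1 - ρ) ε := by
  refine hasGiant_of_forall_reachable (fun v w hv hw => ?_) hρ hsmallH
  have hlarge : ∀ w, w ∉ smallVertices H L → ∃ x, H.Reachable w x ∧ x ∉ smallVertices G L := by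
    refine fun w hw => exists_reachable_notMem_smallVertices hGH hw ?_
    have hdw := hH w (notMem_smallVertices.1 hw)
    have hcard : ((smallVertices G L).card : ℝ) <
        (smallVertices H L).card + (cluster H {w}).card := by
      linarith [(abs_lt.1 hsmallG).2, (abs_lt.1 hsmallH).1]
    exact_mod_cast hcard
  obtain ⟨x, hvx, hx⟩ := hlarge v hv
  obtain ⟨y, hwy, hy⟩ := hlarge w hw
  exact hvx.trans ((hjoin x y (hG x (notMem_smallVertices.1 hx))
    (hG y (notMem_smallVertices.1 hy))).trans hwy.symm)

end Giant

section Negligible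

variable {Ω : ℕ → Type*} [∀ n, MeasurableSpace (Ω n)] {μ : ∀ n, Measure (Ω n)}
  {E F : ∀ n, Set (Ω n)}

/-- The probability of the event `E n` tends to `0` as `n` tends to infinity. -/
def Negligible (μ : ∀ n, Measure (Ω n)) (E : ∀ n, Set (Ω n)) : Prop :=
  Tendsto (fun n => (μ n).real (E n)) atTop (𝓝 0)

lemma negligible_of_eventually_le {f : ℕ → ℝ} (hf : Tendsto f atTop (𝓝 0))
    (h : ∀ᶠ n in atTop, (μ n).real (E n) ≤ f n) : Negligible μ E :=
  squeeze_zero' (.of_forall fun _ => measureReal_nonneg) h hf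

lemma Negligible.union (hE : Negligible μ E) (hF : Negligible μ F) :
    Negligible μ fun n => E n ∪ F n :=
  negligible_of_eventually_le (by simpa using Tendsto.add hE hF)
    (.of_forall fun n => measureReal_union_le (E n) (F n))

variable [∀ n, IsProbabilityMeasure (μ n)]

lemma Negligible.mono (hF : Negligible μ F) (h : ∀ n, E n ⊆ F n) : Negligible μ E :=
  negligible_of_eventually_le hF (.of_forall fun n => measureReal_mono (h n))

lemma Negligible.tendsto_measure (hE : Negligible μ E) :
    Tendsto (fun n => μ n (E n)) atTop (𝓝 0) :=
  (ENNReal.tendsto_toReal_iff (fun n => measure_ne_top (μ n) (E n)) ENNReal.zero_ne_top).1 hE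

lemma tendsto_measure_one_of_negligible_compl (hE : Negligible μ fun n => (E n)ᶜ)
    (hmeas : ∀ n, MeasurableSet (E n)) : Tendsto (fun n => μ n (E n)) atTop (𝓝 1) := by
  have h := ENNReal.Tendsto.sub (tendsto_const_nhds (x := (1 : ENNReal))) hE.tendsto_measure
    (.inl ENNReal.one_ne_top)
  rw [tsub_zero] at h
  refine h.congr fun n => ?_
  rw [← prob_compl_eq_one_sub (hmeas n).compl, compl_compl]

lemma measureReal_exists_le {α ι : Type*} [MeasurableSpace α] [Fintype ι] {ν : Measure α}
    [IsFiniteMeasure ν] {P : ι → α → Prop} {c : ℝ} (h : ∀ i, ν.real {ω | P i ω} ≤ c) :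
    ν.real {ω | ∃ i, P i ω} ≤ Fintype.card ι * c := by
  calc ν.real {ω | ∃ i, P i ω} = ν.real (⋃ i, {ω | P i ω}) := by
        congr 1
        ext ω
        simp
    _ ≤ ∑ i, ν.real {ω | P i ω} := measureReal_iUnion_fintype_le _
    _ ≤ Fintype.card ι * c := by
        simpa using Finset.sum_le_sum fun i (_ : i ∈ Finset.univ) => h i

end Negligible

section Limits

lemma rpow_neg_two_div_log_mul_log {s x : ℝ} (hs : 1 < s) (hx : 0 < x) :
    s ^ (-(2 / Real.log s * Real.log x)) = 1 / x ^ 2 := by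
  have hlog : Real.log s ≠ 0 := (Real.log_pos hs).ne'
  have hexp : Real.log s * -(2 / Real.log s * Real.log x) = -(((2 : ℕ) : ℝ) * Real.log x) := by
    field_simp
    push_cast
    ring
  rw [Real.rpow_def_of_pos (one_pos.trans hs), hexp, Real.exp_neg, Real.exp_nat_mul,
    Real.exp_log hx, one_div]

lemma tendsto_pow_mul_exp_neg_mul_atTop (k : ℕ) {c : ℝ} (hc : 0 < c) :
    Tendsto (fun x : ℝ => x ^ k * Real.exp (-(c * x))) atTop (𝓝 0) := by
  have h := ((Real.tendsto_pow_mul_exp_neg_atTop_nhds_zero k).comp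
    (tendsto_id.const_mul_atTop hc)).const_mul ((c ^ k)⁻¹)
  rw [mul_zero] at h
  refine h.congr fun x => ?_
  simp only [Function.comp, id, mul_pow]
  field_simp

lemma tendsto_log_div_natCast : Tendsto (fun n : ℕ => Real.log n / n) atTop (𝓝 0) :=
  Real.isLittleO_log_id_atTop.tendsto_div_nhds_zero.comp tendsto_natCast_atTop_atTop

lemma tendsto_ceil_sqrt_div_natCast :
    Tendsto (fun n : ℕ => (⌈√(n : ℝ)⌉₊ : ℝ) / n) atTop (𝓝 0) := by
  have hsqrt : Tendsto (fun n : ℕ => √(n : ℝ)) atTop atTop :=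
    Real.tendsto_sqrt_atTop.comp tendsto_natCast_atTop_atTop
  have h := (tendsto_nat_ceil_div_atTop (R := ℝ)).comp hsqrt |>.mul hsqrt.inv_tendsto_atTop
  rw [mul_zero] at h
  refine h.congr fun n => ?_
  simp only [Function.comp, Pi.inv_apply]
  rw [← div_eq_mul_inv, div_div, Real.mul_self_sqrt (Nat.cast_nonneg n)]

end Limits

section Parameters

variable {β γ : ℝ} {n : ℕ}

lemma natCast_mul_edgeProb (hγ : 0 ≤ γ) (hn : 0 < n) (h : γ ≤ n) :
    n * (edgeProb γ n : ℝ) = γ := by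
  have hn' : (0 : ℝ) < n := Nat.cast_pos.2 hn
  rw [edgeProb, Set.projIcc_of_mem _ ⟨by positivity, (div_le_one hn').2 h⟩]
  field_simp

lemma eventually_natCast_mul_edgeProb (hγ : 0 ≤ γ) :
    ∀ᶠ n : ℕ in atTop, n * (edgeProb γ n : ℝ) = γ := by
  filter_upwards [eventually_gt_atTop 0, tendsto_natCast_atTop_atTop.eventually_ge_atTop γ]
    with n hn hγn
  exact natCast_mul_edgeProb hγ hn hγn

lemma tendsto_edgeProb (hγ : 0 ≤ γ) : Tendsto (fun n => (edgeProb γ n : ℝ)) atTop (𝓝 0) := by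
  refine (tendsto_const_div_atTop_nhds_zero_nat γ).congr' ?_
  filter_upwards [eventually_natCast_mul_edgeProb hγ, eventually_gt_atTop 0] with n hnp hn
  rw [div_eq_iff (Nat.cast_ne_zero.2 hn.ne'), mul_comm, hnp]

lemma eventually_auxCount_mul_edgeProb_le (hβ : 0 ≤ β) (hγ : 0 ≤ γ) :
    ∀ᶠ n : ℕ in atTop, auxCount β n * (edgeProb γ n : ℝ) ≤ β * γ := by
  filter_upwards [eventually_natCast_mul_edgeProb hγ] with n hnp
  calc auxCount β n * (edgeProb γ n : ℝ) ≤ β * n * (edgeProb γ n : ℝ) :=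
        mul_le_mul_of_nonneg_right (Nat.floor_le (by positivity)) (edgeProb γ n).2.1
    _ = β * γ := by rw [mul_assoc, hnp]

lemma tendsto_auxCount_mul_edgeProb (hβ : 0 ≤ β) (hγ : 0 ≤ γ) :
    Tendsto (fun n => auxCount β n * (edgeProb γ n : ℝ)) atTop (𝓝 (β * γ)) := by
  have h := ((tendsto_nat_floor_mul_div_atTop hβ).comp
    (tendsto_natCast_atTop_atTop (R := ℝ))).mul_const γ
  refine h.congr' ?_
  filter_upwards [eventually_natCast_mul_edgeProb hγ, eventually_gt_atTop 0] with n hnp hn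
  have hn' : (n : ℝ) ≠ 0 := Nat.cast_ne_zero.2 hn.ne'
  nth_rw 1 [← hnp]
  simp only [Function.comp, auxCount]
  field_simp

lemma tendsto_ceil_sqrt_mul_edgeProb (hγ : 0 ≤ γ) :
    Tendsto (fun n : ℕ => ⌈√(n : ℝ)⌉₊ * (edgeProb γ n : ℝ)) atTop (𝓝 0) := by
  have h := tendsto_ceil_sqrt_div_natCast.mul_const γ
  rw [zero_mul] at h
  refine h.congr' ?_
  filter_upwards [eventually_natCast_mul_edgeProb hγ, eventually_gt_atTop 0] with n hnp hn
  have hn' : (n : ℝ) ≠ 0 := Nat.cast_ne_zero.2 hn.ne'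
  nth_rw 1 [← hnp]
  field_simp

lemma exists_finset_card_compl (m k : ℕ) (h : k ≤ m) :
    ∃ A : Finset (Fin m), A.card = m - k ∧ Aᶜ.card = k := by
  obtain ⟨D, -, hD⟩ := Finset.exists_subset_card_eq (s := (Finset.univ : Finset (Fin m)))
    (n := k) (by simpa using h)
  exact ⟨Dᶜ, by rw [Finset.card_compl, Fintype.card_fin, hD], by rw [compl_compl, hD]⟩

lemma exists_reservoir (hβ : 0 < β) (hγ : 0 < γ) :
    ∃ A : ∀ n, Finset (Fin (auxCount β n)),
      Tendsto (fun n => ((A n).card : ℝ) * edgeProb γ n) atTop (𝓝 (β * γ)) ∧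
      ∀ᶠ n : ℕ in atTop, √(n : ℝ) ≤ ((A n)ᶜ).card := by
  choose A hA hAc using fun n : ℕ =>
    exists_finset_card_compl (auxCount β n) (min ⌈√(n : ℝ)⌉₊ (auxCount β n)) (min_le_right _ _)
  have hdiff := (tendsto_auxCount_mul_edgeProb hβ.le hγ.le).sub
    (tendsto_ceil_sqrt_mul_edgeProb hγ.le)
  rw [sub_zero] at hdiff
  have hle : ∀ᶠ n : ℕ in atTop, ⌈√(n : ℝ)⌉₊ ≤ auxCount β n := by
    filter_upwards [hdiff.eventually_const_lt (mul_pos hβ hγ)] with n hn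
    rw [sub_pos] at hn
    exact_mod_cast (lt_of_mul_lt_mul_right hn (edgeProb γ n).2.1).le
  refine ⟨A, hdiff.congr' ?_, ?_⟩
  · filter_upwards [hle] with n hn
    rw [hA, min_eq_left hn, Nat.cast_sub hn, sub_mul]
  · filter_upwards [hle] with n hn
    rw [hAc, min_eq_left hn]
    exact Nat.le_ceil _

end Parameters

section AsymptoticallyAlmostSurely

variable {β γ : ℝ} {Q R : (n : ℕ) → SimpleGraph (Fin n) → Prop}

/-- The law of the random bipartite graph with `n` vertices, `⌊β n⌋` auxiliary vertices and edge
probability `γ / n`. -/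
noncomputable abbrev sparseLaw (β γ : ℝ) (n : ℕ) : Measure (Bipartite n (auxCount β n)) :=
  bipartiteLaw n (auxCount β n) (edgeProb γ n)

lemma aas_of_negligible
    (h : Negligible (sparseLaw β γ) fun n => {B | ¬ Q n (intersectionGraph B)}) : AAS β γ Q :=
  tendsto_measure_one_of_negligible_compl h fun _ => (Set.toFinite _).measurableSet

lemma AAS.mono (hQ : AAS β γ Q) (h : ∀ n G, Q n G → R n G) : AAS β γ R :=
  tendsto_of_tendsto_of_tendsto_of_le_of_le' hQ tendsto_const_nhds
    (.of_forall fun n => measure_mono fun B => h n (intersectionGraph B))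
    (.of_forall fun _ => prob_le_one)

lemma tendstoInProb_of_aas {X : (n : ℕ) → SimpleGraph (Fin n) → ℝ} {a : ℝ}
    (h : ∀ ε > 0, AAS β γ fun n G => |X n G - a| < ε) : TendstoInProb β γ X a := by
  intro ε hε
  have hcompl := ENNReal.Tendsto.sub (tendsto_const_nhds (x := (1 : ENNReal))) (h ε hε)
    (.inl ENNReal.one_ne_top)
  rw [tsub_self] at hcompl
  refine hcompl.congr fun n => ?_
  rw [prob, ← prob_compl_eq_one_sub (Set.toFinite _).measurableSet]
  congr 1
  ext B
  simp

end AsymptoticallyAlmostSurely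

section Subcritical

variable {β γ : ℝ}

theorem aas_componentSize_le (hβ : 0 ≤ β) (hγ : 0 ≤ γ) (h : β * γ ^ 2 < 1) :
    ∃ C : ℝ, 0 < C ∧
      AAS β γ fun n G => ∀ c : G.ConnectedComponent, (componentSize c : ℝ) ≤ C * Real.log n := by
  obtain ⟨K, s, hs, htail⟩ := exists_card_cluster_tail (a := β * γ) hγ (by linarith)
  refine ⟨2 / Real.log s, div_pos two_pos (Real.log_pos hs), aas_of_negligible ?_⟩
  have hlim : Tendsto (fun n : ℕ => K * (1 / (n : ℝ))) atTop (𝓝 0) := by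
    simpa using tendsto_one_div_atTop_nhds_zero_nat.const_mul K
  refine negligible_of_eventually_le hlim ?_
  filter_upwards [eventually_natCast_mul_edgeProb hγ, eventually_auxCount_mul_edgeProb_le hβ hγ,
    eventually_gt_atTop 0] with n hnp hmp hn
  have hn' : (0 : ℝ) < n := Nat.cast_pos.2 hn
  have hunion := measureReal_exists_le
    fun v => htail hmp hnp.le Finset.univ v (2 / Real.log s * Real.log n)
  refine (measureReal_mono fun B hB => ?_).trans (hunion.trans_eq ?_)
  · simp only [Set.mem_ofPred_eq, not_forall, not_le] at hB ⊢
    obtain ⟨c, hc⟩ := hB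
    induction c using SimpleGraph.ConnectedComponent.ind with | _ v =>
    rw [componentSize_mk] at hc
    rw [intersectionGraphVia_univ]
    exact ⟨v, hc.le⟩
  · rw [rpow_neg_two_div_log_mul_log hs hn', Fintype.card_fin]
    field_simp

end Subcritical

section Supercritical

variable {β γ ρ ζ ε δ : ℝ} {A : ∀ n, Finset (Fin (auxCount β n))} {L : ℕ → ℝ}

lemma exists_negligible_intermediate_clusters (hβ : 0 < β) (hγ : 0 < γ) (hζ : 0 ≤ ζ) (hζ1 : ζ ≤ 1)
    (h : cpoissonGF (β * γ) γ ζ < ζ) :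
    ∃ δ > (0 : ℝ), ∃ C > (0 : ℝ), ∀ A : ∀ n, Finset (Fin (auxCount β n)),
      Tendsto (fun n => ((A n).card : ℝ) * edgeProb γ n) atTop (𝓝 (β * γ)) →
      Negligible (sparseLaw β γ) fun n => {B | ∃ v,
        C * Real.log n ≤ (cluster (intersectionGraphVia B (A n)) {v}).card ∧
        (cluster (intersectionGraphVia B (A n)) {v}).card ≤ δ * n} := by
  obtain ⟨δ, hδ, s, hs, c, hc, a₀, ha₀, hgap⟩ :=
    exists_card_cluster_gap (mul_pos hβ hγ) hγ hζ hζ1 h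
  refine ⟨δ, hδ, 2 / Real.log s, div_pos two_pos (Real.log_pos hs), fun A hA => ?_⟩
  have hlim : Tendsto (fun n : ℕ => ζ * (1 / (n : ℝ)) + 2 * ((n : ℝ) ^ 1 * Real.exp (-(c * n))))
      atTop (𝓝 0) := by
    simpa using (tendsto_one_div_atTop_nhds_zero_nat.const_mul ζ).add
      (((tendsto_pow_mul_exp_neg_mul_atTop 1 hc).comp tendsto_natCast_atTop_atTop).const_mul 2)
  refine negligible_of_eventually_le hlim ?_
  filter_upwards [eventually_natCast_mul_edgeProb hγ.le,
    eventually_auxCount_mul_edgeProb_le hβ.le hγ.le, hA.eventually_const_le ha₀,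
    eventually_gt_atTop 0] with n hnp hmp hAp hn
  have hn' : (0 : ℝ) < n := Nat.cast_pos.2 hn
  refine (measureReal_exists_le (c := ζ * s ^ (-(2 / Real.log s * Real.log n)) +
    2 * Real.exp (-(c * n))) fun v => ?_).trans_eq ?_
  · simpa only [Finset.card_singleton, pow_one] using
      hgap hmp hnp hAp {v} (2 / Real.log s * Real.log n)
  rw [rpow_neg_two_div_log_mul_log hs hn', Fintype.card_fin]
  field_simp

lemma eventually_le_measureReal_card_cluster_le (hβ : 0 ≤ β) (hγ : 0 ≤ γ)
    (hρ : IsLeast {s : ℝ | 0 ≤ s ∧ s = cpoissonGF (β * γ) γ s} ρ) (hρ1 : ρ ≤ 1) (hζ : ζ < ρ)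
    (hL : Tendsto L atTop atTop) :
    ∀ᶠ n in atTop, ∀ (A : Finset (Fin (auxCount β n))) (v : Fin n), ζ ≤ (sparseLaw β γ n).real
      {B | (cluster (intersectionGraphVia B A) {v}).card ≤ L n} := by
  obtain ⟨η, hη, hηρ⟩ := exists_between (max_lt (leastFixedPoint_pos hρ) hζ)
  obtain ⟨hη0, hζη⟩ := max_lt_iff.1 hη
  obtain ⟨s, hs0, hs1, p₀, hp₀, hsmall⟩ := exists_le_measureReal_card_cluster_le
    (mul_nonneg hβ hγ) hγ hη0.le (hηρ.le.trans hρ1)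
    (lt_cpoissonGF_of_lt_leastFixedPoint hρ hη0.le hηρ)
  have hlim : Tendsto (fun n => η - s ^ L n) atTop (𝓝 η) := by
    simpa using ((tendsto_rpow_atTop_of_base_lt_one s (by linarith) hs1).comp hL).const_sub η
  filter_upwards [eventually_natCast_mul_edgeProb hγ, eventually_auxCount_mul_edgeProb_le hβ hγ,
    (tendsto_edgeProb hγ).eventually_le_const hp₀, hlim.eventually_const_le hζη]
    with n hnp hmp hp hn A v
  exact hn.trans (hsmall hp hmp hnp.le A v (L n))

lemma eventually_measureReal_card_cluster_pair_le (hβ : 0 < β) (hγ : 0 < γ)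
    (hρ : IsLeast {s : ℝ | 0 ≤ s ∧ s = cpoissonGF (β * γ) γ s} ρ) (hρ1 : ρ < 1) (hζ : ρ ^ 2 < ζ)
    (hA : Tendsto (fun n => ((A n).card : ℝ) * edgeProb γ n) atTop (𝓝 (β * γ)))
    (hL : Tendsto (fun n => L n / n) atTop (𝓝 0)) :
    ∀ᶠ n in atTop, ∀ v w : Fin n, v ≠ w → (sparseLaw β γ n).real
      {B | (cluster (intersectionGraphVia B (A n)) {v, w}).card ≤ 2 * L n} ≤ ζ := by
  obtain ⟨η, ⟨hηζ, hη1⟩, hρη⟩ : ∃ η, (η ^ 2 < ζ ∧ η < 1) ∧ ρ < η :=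
    ((((continuous_pow 2).continuousAt.eventually_lt_const hζ).and
      (eventually_lt_nhds hρ1)).filter_mono nhdsWithin_le_nhds |>.and
      (self_mem_nhdsWithin (s := Set.Ioi ρ))).exists
  obtain ⟨δ, hδ, s, -, c, hc, a₀, ha₀, hgap⟩ := exists_card_cluster_gap (mul_pos hβ hγ) hγ
    ((leastFixedPoint_pos hρ).trans hρη).le hη1.le
    (cpoissonGF_lt_of_leastFixedPoint_lt hρ (mul_pos hβ hγ) hγ.ne' hρη hη1)
  have hlim : Tendsto (fun n : ℕ => η ^ 2 + 4 * ((n : ℝ) ^ 0 * Real.exp (-(c * n)))) atTop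
      (𝓝 (η ^ 2)) := by
    simpa using (((tendsto_pow_mul_exp_neg_mul_atTop 0 hc).comp
      tendsto_natCast_atTop_atTop).const_mul 4).const_add (η ^ 2)
  filter_upwards [eventually_natCast_mul_edgeProb hγ.le,
    eventually_auxCount_mul_edgeProb_le hβ.le hγ.le, hA.eventually_const_le ha₀,
    hlim.eventually_le_const hηζ, hL.eventually_le_const (half_pos hδ), eventually_gt_atTop 0]
    with n hnp hmp hAp hζn hLn hn v w hvw
  rw [div_le_iff₀ (Nat.cast_pos.2 hn)] at hLn
  refine (measureReal_mono fun B hB => ?_).trans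
    ((hgap hmp hnp hAp {v, w} 0).trans (le_of_eq ?_ |>.trans hζn))
  · exact ⟨Nat.cast_nonneg _, le_trans hB (by linarith)⟩
  · rw [Finset.card_pair hvw, neg_zero, Real.rpow_zero]
    ring

lemma card_smallVertices_eq_sum {n m : ℕ} (A : Finset (Fin m)) (B : Bipartite n m) (x : ℝ) :
    ((smallVertices (intersectionGraphVia B A) x).card : ℝ) = ∑ v,
      {B : Bipartite n m |
        ((cluster (intersectionGraphVia B A) {v}).card : ℝ) ≤ x}.indicator 1 B := by
  classical
  simp [smallVertices, Set.indicator_apply]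

lemma card_cluster_pair_le {V : Type*} [Fintype V] [DecidableEq V] {G : SimpleGraph V} {v w : V}
    {x : ℝ} (hv : ((cluster G {v}).card : ℝ) ≤ x) (hw : ((cluster G {w}).card : ℝ) ≤ x) :
    ((cluster G {v, w}).card : ℝ) ≤ 2 * x := by
  have hcard : ((cluster G {v, w}).card : ℝ) ≤ (cluster G {v}).card + (cluster G {w}).card := by
    exact_mod_cast (Finset.card_le_card cluster_pair_subset).trans (Finset.card_union_le _ _)
  linarith

lemma negligible_abs_card_smallVertices_sub (hβ : 0 < β) (hγ : 0 < γ)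
    (hρ : IsLeast {s : ℝ | 0 ≤ s ∧ s = cpoissonGF (β * γ) γ s} ρ) (hρ1 : ρ < 1) (hε : 0 < ε)
    (hA : Tendsto (fun n => ((A n).card : ℝ) * edgeProb γ n) atTop (𝓝 (β * γ)))
    (hL : Tendsto L atTop atTop) (hL0 : Tendsto (fun n => L n / n) atTop (𝓝 0)) :
    Negligible (sparseLaw β γ) fun n => {B | ε * n ≤
      |((smallVertices (intersectionGraphVia B (A n)) (L n)).card : ℝ) - ρ * n|} := by
  have hρ0 := leastFixedPoint_pos hρ
  refine tendsto_order.2 ⟨fun κ hκ => .of_forall fun n => hκ.trans_le measureReal_nonneg,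
    fun κ hκ => ?_⟩
  obtain ⟨y, hy0, hy⟩ : ∃ y > 0, (1 + 2 * ρ) * y / ε ^ 2 < κ :=
    ⟨κ * ε ^ 2 / (2 * (1 + 2 * ρ)), by positivity, by field_simp; norm_num⟩
  have hlim : Tendsto (fun n : ℕ => (1 / (n : ℝ) + (1 + 2 * ρ) * y) / ε ^ 2) atTop
      (𝓝 ((1 + 2 * ρ) * y / ε ^ 2)) := by
    simpa using (tendsto_one_div_atTop_nhds_zero_nat.add_const ((1 + 2 * ρ) * y)).div_const (ε ^ 2)
  filter_upwards [hlim.eventually_lt_const hy, eventually_gt_atTop 0,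
    eventually_le_measureReal_card_cluster_le hβ.le hγ.le hρ hρ1.le (sub_lt_self ρ hy0) hL,
    eventually_measureReal_card_cluster_pair_le hβ hγ hρ hρ1 (lt_add_of_pos_right (ρ ^ 2) hy0)
      hA hL0] with n hn hn0 hone hpair
  have : Nonempty (Fin n) := ⟨⟨0, hn0⟩⟩
  have hdev := measureReal_le_abs_sum_indicator_sub_le (fun _ => (Set.toFinite _).measurableSet)
    (hone (A n)) (by positivity) (fun v w hvw => (measureReal_mono fun B hB =>
      card_cluster_pair_le hB.1 hB.2).trans (hpair v w hvw)) hρ0.le hε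
  simp only [← card_smallVertices_eq_sum, Fintype.card_fin] at hdev
  refine hdev.trans_lt (hn.trans_eq' ?_)
  ring

lemma negligible_large_clusters_not_joined (hγ : 0 < γ) (hδ : 0 < δ)
    (hA : ∀ᶠ n : ℕ in atTop, √(n : ℝ) ≤ ((A n)ᶜ).card) :
    Negligible (sparseLaw β γ) fun n => {B | ∃ vw : Fin n × Fin n,
      δ * n ≤ (cluster (intersectionGraphVia B (A n)) {vw.1}).card ∧
      δ * n ≤ (cluster (intersectionGraphVia B (A n)) {vw.2}).card ∧
      vw.2 ∉ cluster (intersectionGraph B) {vw.1}} := by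
  have hexp : Real.exp (-(γ * δ)) < 1 := Real.exp_lt_one_iff.2 (neg_neg_of_pos (mul_pos hγ hδ))
  set t := (1 - Real.exp (-(γ * δ))) ^ 2 with ht
  have ht0 : 0 < t := pow_pos (sub_pos.2 hexp) 2
  have ht1 : t ≤ 1 := pow_le_one₀ (sub_pos.2 hexp).le (by linarith [Real.exp_pos (-(γ * δ))])
  have hlim : Tendsto (fun n : ℕ => √(n : ℝ) ^ 4 * Real.exp (-(t * √(n : ℝ)))) atTop (𝓝 0) :=
    (tendsto_pow_mul_exp_neg_mul_atTop 4 ht0).comp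
      (Real.tendsto_sqrt_atTop.comp tendsto_natCast_atTop_atTop)
  refine negligible_of_eventually_le hlim ?_
  filter_upwards [eventually_natCast_mul_edgeProb hγ.le, hA] with n hnp hAn
  have hpow : (1 - t) ^ ((A n)ᶜ).card ≤ Real.exp (-(t * √(n : ℝ))) := by
    calc (1 - t) ^ ((A n)ᶜ).card ≤ Real.exp (-t) ^ ((A n)ᶜ).card :=
          pow_le_pow_left₀ (sub_nonneg.2 ht1) (Real.one_sub_le_exp_neg t) _
      _ = Real.exp (((A n)ᶜ).card * -t) := (Real.exp_nat_mul _ _).symm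
      _ ≤ Real.exp (-(t * √(n : ℝ))) := Real.exp_le_exp.2 (by nlinarith)
  have hunion := measureReal_exists_le (ν := sparseLaw β γ n) fun vw : Fin n × Fin n =>
    measureReal_large_clusters_not_joined_le (A n) vw.1 vw.2 (d := δ * n) (by positivity)
  have hpd : (edgeProb γ n : ℝ) * (δ * n) = γ * δ := by
    rw [mul_left_comm, mul_comm _ (n : ℝ), hnp, mul_comm]
  refine hunion.trans ?_
  rw [Fintype.card_prod, Fintype.card_fin, hpd, ← ht]
  calc ((n * n : ℕ) : ℝ) * (1 - t) ^ ((A n)ᶜ).card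
      ≤ ((n * n : ℕ) : ℝ) * Real.exp (-(t * √(n : ℝ))) := by gcongr
    _ = √(n : ℝ) ^ 4 * Real.exp (-(t * √(n : ℝ))) := by
        rw [Nat.cast_mul, show √(n : ℝ) ^ 4 = (√(n : ℝ) * √(n : ℝ)) * (√(n : ℝ) * √(n : ℝ)) by ring,
          Real.mul_self_sqrt (Nat.cast_nonneg n)]

lemma aas_hasGiant_of_negligible (hδ : 2 * ε ≤ δ) (hρ : ρ + ε ≤ 1)
    (hgap : ∀ A' : ∀ n, Finset (Fin (auxCount β n)), (∀ n, A n ⊆ A' n) →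
      Negligible (sparseLaw β γ) fun n => {B | ∃ v,
        L n ≤ (cluster (intersectionGraphVia B (A' n)) {v}).card ∧
        (cluster (intersectionGraphVia B (A' n)) {v}).card ≤ δ * n})
    (hsmall : ∀ A' : ∀ n, Finset (Fin (auxCount β n)), (∀ n, A n ⊆ A' n) →
      Negligible (sparseLaw β γ) fun n => {B | ε * n ≤
        |((smallVertices (intersectionGraphVia B (A' n)) (L n)).card : ℝ) - ρ * n|})
    (hjoin : Negligible (sparseLaw β γ) fun n => {B | ∃ vw : Fin n × Fin n,
      δ * n ≤ (cluster (intersectionGraphVia B (A n)) {vw.1}).card ∧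
      δ * n ≤ (cluster (intersectionGraphVia B (A n)) {vw.2}).card ∧
      vw.2 ∉ cluster (intersectionGraph B) {vw.1}}) :
    AAS β γ fun n G => HasGiant G (L n) (1 - ρ) ε := by
  have hbad := ((((hgap A fun _ => subset_rfl).union
    (hgap (fun _ => Finset.univ) fun _ => Finset.subset_univ _)).union
    (hsmall A fun _ => subset_rfl)).union
    (hsmall (fun _ => Finset.univ) fun _ => Finset.subset_univ _)).union hjoin
  refine aas_of_negligible (hbad.mono fun n B hB => ?_)
  by_contra hgood
  simp only [intersectionGraphVia_univ, Set.mem_union, Set.mem_ofPred_eq, not_or, not_exists,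
    not_and, not_le, not_not, Prod.forall, mem_cluster_singleton] at hgood
  obtain ⟨⟨⟨⟨hgapA, hgapB⟩, hsmallA⟩, hsmallB⟩, hjoinA⟩ := hgood
  refine hB (hasGiant_of_le (G := intersectionGraphVia B (A n)) (d := δ * n) ?_ ?_ hρ
    (fun v hv => (hgapA v hv.le).le) (fun v hv => (hgapB v hv.le).le) ?_ ?_ hjoinA)
  · rw [← intersectionGraphVia_univ]
    exact intersectionGraphVia_mono (Finset.subset_univ _)
  · simpa only [Fintype.card_fin] using mul_le_mul_of_nonneg_right hδ (Nat.cast_nonneg n)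
  · simpa only [Fintype.card_fin] using hsmallA
  · simpa only [Fintype.card_fin] using hsmallB

theorem aas_hasGiant (hβ : 0 < β) (hγ : 0 < γ) (h : 1 < β * γ ^ 2)
    (hρ : IsLeast {s : ℝ | 0 ≤ s ∧ s = cpoissonGF (β * γ) γ s} ρ) :
    ∃ C > (0 : ℝ), ∀ ε > 0, AAS β γ fun n G => HasGiant G (C * Real.log n) (1 - ρ) ε := by
  have hρ1 : ρ < 1 := leastFixedPoint_lt_one hρ (by linarith)
  obtain ⟨ζ, hρζ, hζ1⟩ := exists_between hρ1
  obtain ⟨δ, hδ, C, hC, hgap⟩ := exists_negligible_intermediate_clusters hβ hγ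
    ((leastFixedPoint_pos hρ).trans hρζ).le hζ1.le
    (cpoissonGF_lt_of_leastFixedPoint_lt hρ (mul_pos hβ hγ) hγ.ne' hρζ hζ1)
  have hL : Tendsto (fun n : ℕ => C * Real.log n) atTop atTop :=
    (Real.tendsto_log_atTop.comp tendsto_natCast_atTop_atTop).const_mul_atTop hC
  have hL0 : Tendsto (fun n : ℕ => C * Real.log n / n) atTop (𝓝 0) := by
    simpa [mul_div_assoc] using tendsto_log_div_natCast.const_mul C
  obtain ⟨A, hA, hAc⟩ := exists_reservoir hβ hγ
  have hA' : ∀ A' : ∀ n, Finset (Fin (auxCount β n)), (∀ n, A n ⊆ A' n) →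
      Tendsto (fun n => ((A' n).card : ℝ) * edgeProb γ n) atTop (𝓝 (β * γ)) := fun A' hAA' =>
    tendsto_of_tendsto_of_tendsto_of_le_of_le hA (tendsto_auxCount_mul_edgeProb hβ.le hγ.le)
      (fun n => mul_le_mul_of_nonneg_right (Nat.cast_le.2 (Finset.card_le_card (hAA' n)))
        (edgeProb γ n).2.1)
      (fun n => mul_le_mul_of_nonneg_right (Nat.cast_le.2 (card_finset_fin_le (A' n)))
        (edgeProb γ n).2.1)
  refine ⟨C, hC, fun ε₀ hε₀ => ?_⟩
  obtain ⟨ε, hε, hεlt⟩ := exists_between (lt_min hε₀ (lt_min (half_pos hδ) (sub_pos.2 hρ1)))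
  obtain ⟨hεε₀, hεδ, hερ⟩ : ε < ε₀ ∧ ε < δ / 2 ∧ ε < 1 - ρ := by simpa using hεlt
  have hgiant := aas_hasGiant_of_negligible (by linarith) (by linarith)
    (fun A' hAA' => hgap A' (hA' A' hAA'))
    (fun A' hAA' => negligible_abs_card_smallVertices_sub hβ hγ hρ hρ1 hε (hA' A' hAA') hL hL0)
    (negligible_large_clusters_not_joined hγ hδ hAc)
  exact hgiant.mono fun n G hG => hG.mono hεε₀.le

end Supercritical

end RandomIntersectionGraph

open RandomIntersectionGraph in
theorem theorem1 (β γ : ℝ) (hβ : 0 < β) (hγ : 0 < γ) :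
    (β * γ ^ 2 < 1 →
      ∃ C : ℝ, 0 < C ∧
        AAS β γ fun n G => ∀ c : G.ConnectedComponent, (componentSize c : ℝ) ≤ C * Real.log n) ∧
    (1 < β * γ ^ 2 →
      ∃ ρ : ℝ, IsLeast {s : ℝ | 0 ≤ s ∧ s = cpoissonGF (β * γ) γ s} ρ ∧ 0 < ρ ∧ ρ < 1 ∧
        (TendstoInProb β γ (fun n G => (kthLargestSize G 1 : ℝ) / n) (1 - ρ)) ∧
        ∃ C : ℝ, 0 < C ∧
          (AAS β γ fun n G =>
            ∃! c : G.ConnectedComponent, C * Real.log n < (componentSize c : ℝ)) ∧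
          AAS β γ fun n G => (kthLargestSize G 2 : ℝ) ≤ C * Real.log n) := by
  refine ⟨aas_componentSize_le hβ.le hγ.le, fun h => ?_⟩
  obtain ⟨ρ, hρ⟩ := exists_isLeast_fixedPoint (β * γ) γ
  obtain ⟨C, hC, hgiant⟩ := aas_hasGiant hβ hγ h hρ
  refine ⟨ρ, hρ, leastFixedPoint_pos hρ, leastFixedPoint_lt_one hρ (by linarith),
    tendstoInProb_of_aas fun ε hε => (hgiant ε hε).mono fun n G hG => ?_, C, hC,
    (hgiant 1 one_pos).mono fun _ _ hG => hG.existsUnique,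
    (hgiant 1 one_pos).mono fun n _ hG => hG.kthLargestSize_two_le ?_⟩
  · simpa only [Fintype.card_fin] using hG.abs_kthLargestSize_one_sub_lt
  · exact mul_nonneg hC.le (Real.log_natCast_nonneg n)
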